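/- Notation. For a subset $A$ of an abelian semigroup and an integer $i\ge 1$, let $iA=\{a_1+\cdots+a_i : a_1,\dots,a_i\in A\}$ be the $i$-fold sumset. For a set $A$ of positive integers, $\mathrm{d}(A)=\lim_{N\to\infty}|A\cap[1,N]|/N$ is its asymptotic density, if the limit exists. Let $\mu$ be the Haar probability measure on $\mathbb{T}=\mathbb{R}/\mathbb{Z}$. For $m\ge1$ let $\mathcal{D}_m\subset[0,1]^m$ be the set of all tuples $(\mathrm{d}(A),\mathrm{d}(2A),\dots,\mathrm{d}(mA))$, where $A$ ranges over the sets of positive integers for which all these densities exist; let $\mathcal{E}_m$ be the set of all tuples $(\mu(A),\mu(2A),\dots,\mu(mA))$, where $A$ ranges over the subsets of $\mathbb{T}$ for which $A,2A,\dots,mA$ are all measurable; and let $\mathcal{E}_m^{o}\subset\mathcal{E}_m$ be the set of those tuples that are obtained from an open set $A\subset\mathbb{T}$ whose boundary is $\mu$-null (i.e. $A$ is open and Riemann-measurable). Theorem. Let $k\ge 1$ be an integer and $\alpha=(\alpha_1,\dots,\alpha_{k+1})\in[0,1]^{k+1}$. (a) If $\alpha_1=\cdots=\alpha_{k-1}=0$,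 and if moreover either $\alpha_{k+1}\ge\frac{k+1}{k}\alpha_k$, or $\alpha_{k+1}\ge\alpha_k$ and $\alpha_{k+1}=1/q$ for some integer $q\geq 1$, then $\alpha\in\mathcal{D}_{k+1}$. (b) If $\alpha_1=\cdots=\alpha_k=0$, then $\alpha\in\mathcal{E}_{k+1}$. (c) If there is a real number $a\le\frac{1}{k+1}$ such that $\alpha_i=ia$ for every $i\in\{1,\dots,k+1\}$, then $\alpha\in\mathcal{E}_{k+1}^{o}\subset\mathcal{D}_{k+1}$ (that is, $\alpha\in\mathcal{E}_{k+1}^{o}$, and the inclusion $\mathcal{E}_{k+1}^{o}\subset\mathcal{D}_{k+1}$ holds; in particular $\alpha\in\mathcal{D}_{k+1}$). -/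

import Mathlib

open MeasureTheory Filter Topology

/-- The `k`-fold sumset `kA = {a₁ + ⋯ + a_k : a₁, …, a_k ∈ A}`. -/
def kSumset {G : Type*} [AddCommMonoid G] (k : ℕ) (A : Set G) : Set G :=
  {x | ∃ a : Fin k → G, (∀ j, a j ∈ A) ∧ ∑ j, a j = x}

/-- `A` has an asymptotic density, equal to `d`: `|A ∩ [1, N]| / N → d` as `N → ∞`. -/
def HasAsympDensity (A : Set ℕ) (d : ℝ) : Prop :=
  Tendsto (fun N : ℕ => ((A ∩ Set.Icc 1 N).ncard : ℝ) / (N : ℝ)) atTop (𝓝 d)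

/-- `𝒟_k`: the tuples `(d(A), d(2A), …, d(kA))`, where `A` ranges over the sets of positive
integers for which all these densities exist. The entry with index `j : Fin k` is
`d((j+1)A)`. -/
def densityTuples (k : ℕ) : Set (Fin k → ℝ) :=
  {α | ∃ A : Set ℕ, (∀ a ∈ A, 1 ≤ a) ∧
    ∀ j : Fin k, HasAsympDensity (kSumset ((j : ℕ) + 1) A) (α j)}

/-- `ℰ_k`: the tuples `(μ(A), μ(2A), …, μ(kA))`, where `A` ranges over the subsets of the circle
`𝕋 = ℝ/ℤ` for which `A, 2A, …, kA` are all measurable; `μ` is the Haar probability measure. -/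
def circleTuples (k : ℕ) : Set (Fin k → ℝ) :=
  {α | ∃ A : Set UnitAddCircle, ∀ j : Fin k,
    MeasurableSet (kSumset ((j : ℕ) + 1) A) ∧
      (volume : Measure UnitAddCircle).real (kSumset ((j : ℕ) + 1) A) = α j}

/-- `ℰ_k^o`: the tuples `(μ(A), μ(2A), …, μ(kA))`, where `A` ranges over the open
Riemann-measurable subsets of `𝕋` (Riemann-measurable: the boundary is a null set). -/
def circleOpenTuples (k : ℕ) : Set (Fin k → ℝ) :=
  {α | ∃ A : Set UnitAddCircle, IsOpen A ∧
    (volume : Measure UnitAddCircle) (frontier A) = 0 ∧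
    ∀ j : Fin k, (volume : Measure UnitAddCircle).real (kSumset ((j : ℕ) + 1) A) = α j}

/-! ### Sumsets and asymptotic densities of sets of integers -/

section DensitySumsets

open scoped Pointwise

/-! Densities are modelled on the circle through the equidistributed orbit n ↦ n√2 (`orbit`). If the
elements of B have orbit points in a closed set K, up to a null set of exceptions, then B has upper
density at most μ(K). If B contains all large integers whose orbit points are near a given point of
an open V (`Captures`), it has lower density at least μ(V). When μ(K) = μ(V), the density is
determined (`Captures.hasAsympDensity`).

For (a), digits 0 and 1 in base 2^k give a thin basis of order k: about N^(1/k) elements up to N, so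
that fewer than k summands give density zero. Small corrections let the orbit points of the summands
be steered as well, so the part A₀ of the basis lying over an open arc U satisfies kA₀ ≈ kU and
(k+1)A₀ ≈ (k+1)U (`captures_thinBasis`). A finite set F added to A₀ changes kA₀ only by a null set,
but adds to (k+1)A₀ the translates of kU by the orbit of F. With U of length β/k, these translates
enlarge the arc (k+1)U, of length (k+1)β/k, to any prescribed length γ ≤ 1
(`exists_finite_translates`). If instead γ = 1 and (k+1)β/k > 1, then (k+1)U is already the whole
circle; dilation by q gives the case γ = 1/q.

For (b), the Cantor set of base-2^(k+1) expansions with digits 0 and 1 plays the role of the thin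
basis: self-similarity makes the shorter sumsets null, while rational translates make the (k+1)-fold
sumset fill an interval (`volume_sparseCantor_sum`, `Ioo_subset_nsmul_thinReals`).

For (c), A is an arc of length a. The inclusion comes from taking the integers n whose orbit points
lie in a compact subset of A that grows slowly with n (`exists_hasAsympDensity_of_isOpen`). -/

lemma kSumset_zero {G : Type*} [AddCommMonoid G] (A : Set G) : kSumset 0 A = 0 := by
  ext x
  simp [kSumset, eq_comm]

lemma kSumset_succ {G : Type*} [AddCommMonoid G] (i : ℕ) (A : Set G) :
    kSumset (i + 1) A = kSumset i A + A := by
  ext x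
  simp only [kSumset, Set.mem_ofPred_eq, Set.mem_add]
  constructor
  · rintro ⟨a, ha, rfl⟩
    exact ⟨∑ j : Fin i, a j.castSucc, ⟨_, fun j => ha _, rfl⟩, a (Fin.last i), ha _,
      (Fin.sum_univ_castSucc a).symm⟩
  · rintro ⟨_, ⟨a, ha, rfl⟩, y, hy, rfl⟩
    refine ⟨Fin.snoc (α := fun _ => G) a y, fun j => ?_, ?_⟩
    · refine Fin.lastCases ?_ (fun j => ?_) j
      · simpa using hy
      · simpa using ha j
    · simp [Fin.sum_univ_castSucc]

lemma kSumset_eq_nsmul {G : Type*} [AddCommMonoid G] (i : ℕ) (A : Set G) :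
    kSumset i A = i • A := by
  induction i with
  | zero => rw [kSumset_zero, zero_nsmul]
  | succ i ih => rw [kSumset_succ, ih, succ_nsmul]

/-- A sum either avoids F altogether or has a summand from F, which can be split off. For thin A and
finite F the second part turns out to be negligible. -/
lemma succ_nsmul_union_subset {G : Type*} [AddCommMonoid G] (i : ℕ) (A F : Set G) :
    (i + 1) • (A ∪ F) ⊆ (i + 1) • A ∪ (i • (A ∪ F) + F) := by
  induction i with
  | zero => simp
  | succ i ih =>
    rw [succ_nsmul (A ∪ F) (i + 1), Set.add_union]
    refine Set.union_subset ?_ Set.subset_union_right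
    refine (Set.add_subset_add_right ih).trans ?_
    rw [Set.union_add, ← succ_nsmul]
    refine Set.union_subset_union_right _ ?_
    rw [add_right_comm, succ_nsmul (A ∪ F) i]
    exact Set.add_subset_add_right (Set.add_subset_add_left Set.subset_union_left)

lemma nsmul_subset_preimage {G : Type*} [AddCommMonoid G] (φ : ℕ →+ G) {A : Set ℕ} {U : Set G}
    (h : A ⊆ φ ⁻¹' U) (i : ℕ) : i • A ⊆ φ ⁻¹' (i • U) := by
  rw [← Set.image_subset_iff, Set.image_nsmul]
  exact Set.nsmul_subset_nsmul_left (Set.image_subset_iff.2 h)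

/-- The upper asymptotic density of `A` is at most `d`. -/
def AsympDensityLE (A : Set ℕ) (d : ℝ) : Prop :=
  ∀ ε > 0, ∀ᶠ N : ℕ in atTop, ((A ∩ Set.Icc 1 N).ncard : ℝ) ≤ (d + ε) * N

/-- The lower asymptotic density of `A` is at least `d`. -/
def AsympDensityGE (A : Set ℕ) (d : ℝ) : Prop :=
  ∀ ε > 0, ∀ᶠ N : ℕ in atTop, (d - ε) * N ≤ ((A ∩ Set.Icc 1 N).ncard : ℝ)

lemma hasAsympDensity_of_le_of_ge {A : Set ℕ} {d : ℝ} (h₁ : AsympDensityLE A d)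
    (h₂ : AsympDensityGE A d) : HasAsympDensity A d := by
  rw [HasAsympDensity, Metric.tendsto_nhds]
  intro ε hε
  filter_upwards [h₁ (ε / 2) (half_pos hε), h₂ (ε / 2) (half_pos hε), eventually_gt_atTop 0]
    with N h₁ h₂ hN
  have hN' : (0 : ℝ) < N := by exact_mod_cast hN
  rw [Real.dist_eq, abs_lt]
  constructor
  · rw [lt_sub_iff_add_lt, lt_div_iff₀ hN']
    nlinarith
  · rw [sub_lt_iff_lt_add, div_lt_iff₀ hN']
    nlinarith

lemma ncard_inter_Icc_mono {A B : Set ℕ} (h : A ⊆ B) (N : ℕ) :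
    (A ∩ Set.Icc 1 N).ncard ≤ (B ∩ Set.Icc 1 N).ncard :=
  Set.ncard_le_ncard (Set.inter_subset_inter_left _ h)
    ((Set.finite_Icc 1 N).subset Set.inter_subset_right)

lemma AsympDensityLE.of_subset_union {A B Z : Set ℕ} {d : ℝ} (hB : AsympDensityLE B d)
    (hZ : AsympDensityLE Z 0) (h : A ⊆ B ∪ Z) : AsympDensityLE A d := by
  intro ε hε
  filter_upwards [hB (ε / 2) (half_pos hε), hZ (ε / 2) (half_pos hε)] with N h₁ h₂
  have h₃ : (A ∩ Set.Icc 1 N).ncard ≤ (B ∩ Set.Icc 1 N).ncard + (Z ∩ Set.Icc 1 N).ncard := by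
    refine (ncard_inter_Icc_mono h N).trans ?_
    rw [Set.union_inter_distrib_right]
    exact Set.ncard_union_le _ _
  have h₄ : ((A ∩ Set.Icc 1 N).ncard : ℝ) ≤
      (B ∩ Set.Icc 1 N).ncard + (Z ∩ Set.Icc 1 N).ncard := by exact_mod_cast h₃
  linarith

lemma AsympDensityGE.of_forall_lt {A : Set ℕ} {d : ℝ}
    (h : ∀ d' < d, AsympDensityGE A d') : AsympDensityGE A d := by
  intro ε hε
  filter_upwards [h (d - ε / 2) (by linarith) (ε / 2) (half_pos hε)] with N h₁
  linarith

lemma asympDensityGE_zero (A : Set ℕ) : AsympDensityGE A 0 := by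
  intro ε hε
  filter_upwards with N
  have : (0 : ℝ) ≤ ε * N := by positivity
  have h₂ : (0 : ℝ) ≤ ((A ∩ Set.Icc 1 N).ncard : ℝ) := by positivity
  linarith

lemma finite_inter_Iic (A : Set ℕ) (N : ℕ) : (A ∩ Set.Iic N).Finite :=
  (Set.finite_Iic N).subset Set.inter_subset_right

lemma ncard_add_inter_Iic_le (A B : Set ℕ) (N : ℕ) :
    ((A + B) ∩ Set.Iic N).ncard ≤ (A ∩ Set.Iic N).ncard * (B ∩ Set.Iic N).ncard := by
  rw [← Set.ncard_prod]
  refine le_trans (Set.ncard_le_ncard (t := (fun p : ℕ × ℕ => p.1 + p.2) ''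
    ((A ∩ Set.Iic N) ×ˢ (B ∩ Set.Iic N))) ?_ ?_) (Set.ncard_image_le ?_)
  · rintro _ ⟨⟨a, ha, b, hb, rfl⟩, h⟩
    simp only [Set.mem_Iic] at h
    exact ⟨(a, b), ⟨⟨ha, by simp only [Set.mem_Iic]; omega⟩,
      ⟨hb, by simp only [Set.mem_Iic]; omega⟩⟩, rfl⟩
  · exact ((finite_inter_Iic A N).prod (finite_inter_Iic B N)).image _
  · exact (finite_inter_Iic A N).prod (finite_inter_Iic B N)

lemma ncard_nsmul_inter_Iic_le (A : Set ℕ) (N i : ℕ) :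
    ((i • A) ∩ Set.Iic N).ncard ≤ (A ∩ Set.Iic N).ncard ^ i := by
  induction i with
  | zero =>
    rw [zero_nsmul, pow_zero]
    refine (Set.ncard_le_ncard Set.inter_subset_left (by simp)).trans ?_
    simp [← Set.singleton_zero]
  | succ i ih =>
    rw [succ_nsmul, pow_succ]
    exact (ncard_add_inter_Iic_le _ _ _).trans (Nat.mul_le_mul_right _ ih)

lemma ncard_inter_Iic_le (A : Set ℕ) (N : ℕ) :
    (A ∩ Set.Iic N).ncard ≤ (A ∩ Set.Icc 1 N).ncard + 1 := by
  refine (Set.ncard_le_ncard (t := (A ∩ Set.Icc 1 N) ∪ {0}) ?_ ?_).trans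
    ((Set.ncard_union_le _ _).trans (by simp))
  · rintro n ⟨hn, hN⟩
    rcases Nat.eq_zero_or_pos n with rfl | h
    · simp
    · exact Or.inl ⟨hn, h, hN⟩
  · exact ((Set.finite_Icc 1 N).subset Set.inter_subset_right).union (by simp)

/-- Up to N there are at most (|Z ∩ [1, N]| + 1)·|F| sums; the extra 1 accounts for a possible 0 in
Z, which the density count ignores. -/
lemma AsympDensityLE.add_finite {Z F : Set ℕ} (hZ : AsympDensityLE Z 0) (hF : F.Finite) :
    AsympDensityLE (Z + F) 0 := by
  intro ε hε
  have hc : (0 : ℝ) < F.ncard + 1 := by positivity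
  filter_upwards [hZ (ε / 2 / (F.ncard + 1)) (by positivity),
    (tendsto_natCast_atTop_atTop (R := ℝ)).eventually_ge_atTop (2 * (F.ncard + 1) / ε)] with N h₁ h₂
  have h₃ : ((Z + F) ∩ Set.Icc 1 N).ncard ≤ ((Z ∩ Set.Icc 1 N).ncard + 1) * F.ncard := by
    refine (Set.ncard_le_ncard (t := (Z + F) ∩ Set.Iic N)
      (Set.inter_subset_inter_right _ fun x hx => hx.2) (finite_inter_Iic _ _)).trans ?_
    refine (ncard_add_inter_Iic_le _ _ _).trans ?_
    exact Nat.mul_le_mul (ncard_inter_Iic_le _ _) (Set.ncard_le_ncard Set.inter_subset_left hF)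
  have h₄ : (((Z + F) ∩ Set.Icc 1 N).ncard : ℝ) ≤ ((Z ∩ Set.Icc 1 N).ncard + 1) * F.ncard := by
    exact_mod_cast h₃
  have h₅ : ((Z ∩ Set.Icc 1 N).ncard : ℝ) * (F.ncard + 1) ≤ ε / 2 * N := by
    calc _ ≤ (0 + ε / 2 / (F.ncard + 1)) * N * (F.ncard + 1) := by gcongr
      _ = ε / 2 * N := by field_simp; ring
  rw [div_le_iff₀ hε] at h₂
  have h₆ : (0 : ℝ) ≤ ((Z ∩ Set.Icc 1 N).ncard : ℝ) := by positivity
  nlinarith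

/-- The count up to N is the count of A up to ⌊N/q⌋, and ⌊N/q⌋/N → 1/q. -/
lemma HasAsympDensity.nsmul_image {A : Set ℕ} {d : ℝ} (h : HasAsympDensity A d) {q : ℕ}
    (hq : 0 < q) : HasAsympDensity ((fun n => q * n) '' A) (d / q) := by
  have hq' : (0 : ℝ) < q := by exact_mod_cast hq
  have hcard : ∀ N : ℕ, (((fun n => q * n) '' A) ∩ Set.Icc 1 N).ncard =
      (A ∩ Set.Icc 1 (N / q)).ncard := by
    intro N
    rw [← Set.ncard_image_of_injective (A ∩ Set.Icc 1 (N / q))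
      (f := fun n => q * n) (fun a b h => Nat.eq_of_mul_eq_mul_left hq h)]
    congr 1
    ext x
    simp only [Set.mem_inter_iff, Set.mem_image, Set.mem_Icc]
    constructor
    · rintro ⟨⟨n, hn, rfl⟩, h1, h2⟩
      exact ⟨n, ⟨hn, Nat.pos_of_mul_pos_left h1, (Nat.le_div_iff_mul_le hq).2 (by linarith)⟩, rfl⟩
    · rintro ⟨n, ⟨hn, h1, h2⟩, rfl⟩
      exact ⟨⟨n, hn, rfl⟩, Nat.mul_pos hq h1, by
        have := (Nat.le_div_iff_mul_le hq).1 h2; linarith⟩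
  have h₁ : Tendsto (fun N : ℕ => N / q) atTop atTop := Nat.tendsto_div_const_atTop hq.ne'
  have h₂ : Tendsto (fun N : ℕ => ((N / q : ℕ) : ℝ) / N) atTop (𝓝 (1 / q)) := by
    have := (tendsto_nat_floor_mul_div_atTop (R := ℝ) (a := 1 / q) (by positivity)).comp
      (tendsto_natCast_atTop_atTop (R := ℝ))
    refine this.congr fun N => ?_
    simp only [Function.comp_apply]
    rw [one_div_mul_eq_div, Nat.floor_div_natCast, Nat.floor_natCast]
  have h₃ := (Tendsto.comp h h₁).mul h₂
  rw [mul_one_div] at h₃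
  refine h₃.congr' ?_
  filter_upwards [eventually_ge_atTop q] with N hN
  have : (0 : ℝ) < ((N / q : ℕ) : ℝ) := by exact_mod_cast Nat.div_pos hN hq
  simp only [Function.comp_apply, hcard]
  field_simp

lemma kSumset_nsmul_image (q i : ℕ) (A : Set ℕ) :
    kSumset i ((fun n => q * n) '' A) = (fun n => q * n) '' kSumset i A := by
  rw [kSumset_eq_nsmul, kSumset_eq_nsmul]
  exact (Set.image_nsmul (AddMonoidHom.mulLeft q) A i).symm

end DensitySumsets

/-! ### Equidistribution of the multiples of √2 modulo 1 -/

section Equidistribution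

/-- The orbit of `0` under the rotation of the circle by `√2`. -/
noncomputable def orbit : ℕ →+ UnitAddCircle :=
  multiplesHom UnitAddCircle ((√2 : ℝ) : UnitAddCircle)

lemma orbit_apply (n : ℕ) : orbit n = n • ((√2 : ℝ) : UnitAddCircle) := rfl

lemma integral_fourier (m : ℤ) :
    ∫ x : UnitAddCircle, fourier m x = if m = 0 then 1 else 0 := by
  have h := congrFun (fourierCoeff_fourier (T := 1) m) 0
  have hv : (volume : Measure UnitAddCircle) = AddCircle.haarAddCircle := by
    rw [AddCircle.volume_eq_smul_haarAddCircle]; simp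
  simp only [fourierCoeff, neg_zero, fourier_zero, one_smul, Pi.single_apply] at h
  rw [hv, h]
  simp [eq_comm]

lemma fourier_orbit (m : ℤ) (n : ℕ) :
    fourier m (orbit n) = (fourier m ((√2 : ℝ) : UnitAddCircle)) ^ n := by
  rw [fourier_apply, fourier_apply, orbit_apply, smul_comm, AddCircle.toCircle_nsmul]
  simp

lemma fourier_sqrt_two_ne_one {m : ℤ} (hm : m ≠ 0) :
    (fourier m ((√2 : ℝ) : UnitAddCircle) : ℂ) ≠ 1 := by
  rw [fourier_coe_apply]
  intro h
  obtain ⟨n, hn⟩ := Complex.exp_eq_one_iff.1 h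
  have h1 : (m : ℂ) * ((√2 : ℝ) : ℂ) = n := by
    have : (2 * Real.pi * Complex.I : ℂ) ≠ 0 := Complex.two_pi_I_ne_zero
    apply mul_left_cancel₀ this
    simp only [Complex.ofReal_one, div_one] at hn
    linear_combination hn
  have h2 : (m : ℝ) * √2 = n := by exact_mod_cast h1
  have := (irrational_sqrt_two.intCast_mul hm).ne_int n
  exact this h2

/-- For m ≠ 0 the sum is geometric with ratio z ≠ 1 of modulus 1, by irrationality of √2, hence
bounded by 2/|z - 1| uniformly in N. -/
lemma tendsto_average_fourier (m : ℤ) :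
    Tendsto (fun N : ℕ => (N : ℂ)⁻¹ * ∑ n ∈ Finset.Icc 1 N, fourier m (orbit n)) atTop
      (𝓝 (∫ x : UnitAddCircle, fourier m x)) := by
  rw [integral_fourier]
  split_ifs with hm
  · subst hm
    refine tendsto_const_nhds.congr' ?_
    filter_upwards [eventually_gt_atTop 0] with N hN
    have : (N : ℂ) ≠ 0 := by exact_mod_cast hN.ne'
    simp [this]
  · set z : ℂ := fourier m ((√2 : ℝ) : UnitAddCircle) with hz
    have hz1 : z - 1 ≠ 0 := sub_ne_zero.2 (fourier_sqrt_two_ne_one hm)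
    have hn : ‖z‖ = 1 := by
      rw [hz, fourier_apply]; exact Circle.norm_coe _
    rw [tendsto_zero_iff_norm_tendsto_zero]
    refine squeeze_zero (g := fun N : ℕ => (N : ℝ)⁻¹ * (2 / ‖z - 1‖)) (fun N => norm_nonneg _)
      (fun N => ?_) ?_
    · have hs : ∑ n ∈ Finset.Icc 1 N, fourier m (orbit n) = z * ((z ^ N - 1) / (z - 1)) := by
        rw [← geom_sum_eq (sub_ne_zero.1 hz1), Finset.mul_sum]
        clear_value z
        induction N with
        | zero => simp
        | succ N ih =>
          rw [Finset.sum_Icc_succ_top (by omega), Finset.sum_range_succ, ih, fourier_orbit, ← hz,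
            pow_succ']
      rw [hs, norm_mul, norm_mul, norm_div, hn, one_mul, norm_inv, Complex.norm_natCast]
      gcongr
      refine (norm_sub_le _ _).trans ?_
      rw [norm_pow, hn]; norm_num
    · have := (tendsto_inv_atTop_nhds_zero_nat (𝕜 := ℝ)).mul_const (2 / ‖z - 1‖)
      rwa [zero_mul] at this

lemma norm_average_orbit_le (f : C(UnitAddCircle, ℂ)) (N : ℕ) :
    ‖(N : ℂ)⁻¹ * ∑ n ∈ Finset.Icc 1 N, f (orbit n)‖ ≤ ‖f‖ := by
  rw [norm_mul, norm_inv, Complex.norm_natCast]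
  have h : ‖∑ n ∈ Finset.Icc 1 N, f (orbit n)‖ ≤ N * ‖f‖ := by
    refine (norm_sum_le_of_le _ fun n _ => f.norm_coe_le_norm (orbit n)).trans ?_
    simp
  rcases Nat.eq_zero_or_pos N with rfl | hN
  · simp
  · have hN' : (0 : ℝ) < N := by exact_mod_cast hN
    rw [inv_mul_le_iff₀ hN']
    exact h

/-- **Weyl's equidistribution theorem** for the rotation by `√2`. -/
lemma tendsto_average_orbit (f : C(UnitAddCircle, ℂ)) :
    Tendsto (fun N : ℕ => (N : ℂ)⁻¹ * ∑ n ∈ Finset.Icc 1 N, f (orbit n)) atTop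
      (𝓝 (∫ x : UnitAddCircle, f x)) := by
  have hint : ∀ f : C(UnitAddCircle, ℂ), Integrable f (volume : Measure UnitAddCircle) :=
    fun f => f.continuous.integrable_of_hasCompactSupport (HasCompactSupport.of_compactSpace f)
  have hspan : ∀ f ∈ Submodule.span ℂ (Set.range (@fourier 1)),
      Tendsto (fun N : ℕ => (N : ℂ)⁻¹ * ∑ n ∈ Finset.Icc 1 N, f (orbit n)) atTop
        (𝓝 (∫ x : UnitAddCircle, f x)) := by
    intro f hf
    induction hf using Submodule.span_induction with
    | mem f hf =>
      obtain ⟨m, rfl⟩ := hf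
      exact tendsto_average_fourier m
    | zero => simp
    | add f g _ _ hf hg =>
      simp only [ContinuousMap.add_apply, Finset.sum_add_distrib, mul_add]
      rw [integral_add (hint f) (hint g)]
      exact hf.add hg
    | smul c f _ hf =>
      simp only [ContinuousMap.smul_apply, ← Finset.smul_sum, mul_smul_comm]
      rw [integral_smul]
      exact hf.const_smul c
  have hf : f ∈ (Submodule.span ℂ (Set.range (@fourier 1))).topologicalClosure := by
    rw [span_fourier_closure_eq_top]; trivial
  rw [Metric.tendsto_nhds]
  intro ε hε
  obtain ⟨g, hg, hfg⟩ := Metric.mem_closure_iff.1 hf (ε / 3) (by positivity)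
  filter_upwards [(Metric.tendsto_nhds.1 (hspan g hg)) (ε / 3) (by positivity)] with N hN
  rw [dist_eq_norm] at hfg hN ⊢
  have h1 := norm_average_orbit_le (f - g) N
  have h2 : ‖∫ x : UnitAddCircle, (g - f) x‖ ≤ ‖f - g‖ := by
    rw [norm_sub_rev f g]
    have := norm_integral_le_of_norm_le_const (μ := (volume : Measure UnitAddCircle))
      (Eventually.of_forall (g - f).norm_coe_le_norm)
    simpa [measureReal_def] using this
  simp only [ContinuousMap.sub_apply, Finset.sum_sub_distrib, mul_sub] at h1
  simp only [ContinuousMap.sub_apply] at h2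
  rw [integral_sub (hint g) (hint f)] at h2
  calc _ = ‖((N : ℂ)⁻¹ * ∑ n ∈ Finset.Icc 1 N, f (orbit n)
        - (N : ℂ)⁻¹ * ∑ n ∈ Finset.Icc 1 N, g (orbit n))
        + ((N : ℂ)⁻¹ * ∑ n ∈ Finset.Icc 1 N, g (orbit n) - ∫ x : UnitAddCircle, g x)
        + ((∫ x : UnitAddCircle, g x) - ∫ x : UnitAddCircle, f x)‖ := by congr 1; ring
    _ ≤ _ := norm_add₃_le
    _ < ε := by linarith

lemma tendsto_average_orbit_real (f : C(UnitAddCircle, ℝ)) :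
    Tendsto (fun N : ℕ => (N : ℝ)⁻¹ * ∑ n ∈ Finset.Icc 1 N, f (orbit n)) atTop
      (𝓝 (∫ x : UnitAddCircle, f x)) := by
  have h := tendsto_average_orbit ⟨fun x => (f x : ℂ), by fun_prop⟩
  simp only [ContinuousMap.coe_mk] at h
  rw [integral_complex_ofReal] at h
  have h2 := (Complex.continuous_re.tendsto _).comp h
  rw [Complex.ofReal_re] at h2
  refine h2.congr fun N => ?_
  simp only [Function.comp_apply]
  rw [← Complex.ofReal_natCast, ← Complex.ofReal_sum, ← Complex.ofReal_inv, ← Complex.ofReal_mul,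
    Complex.ofReal_re]

lemma ncard_preimage_orbit (K : Set UnitAddCircle) (N : ℕ) :
    (((orbit ⁻¹' K) ∩ Set.Icc 1 N).ncard : ℝ) =
      ∑ n ∈ Finset.Icc 1 N, K.indicator (fun _ => (1 : ℝ)) (orbit n) := by
  classical
  have : (orbit ⁻¹' K) ∩ Set.Icc 1 N = ↑((Finset.Icc 1 N).filter fun n => orbit n ∈ K) := by
    ext; simp [and_comm]
  rw [this, Set.ncard_coe_finset, Finset.card_filter]
  push_cast
  exact Finset.sum_congr rfl fun n _ => by simp [Set.indicator_apply]

/-- Outer regularity gives an open V ⊇ K of nearly the same measure. A Urysohn function equal to 1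
on K and vanishing off V dominates the indicator of K, and Weyl's theorem applies to it. -/
lemma asympDensityLE_preimage_orbit {K : Set UnitAddCircle} (hK : IsClosed K) :
    AsympDensityLE (orbit ⁻¹' K) ((volume : Measure UnitAddCircle).real K) := by
  intro ε hε
  obtain ⟨V, hKV, hV, hVm⟩ := K.exists_isOpen_lt_add (μ := (volume : Measure UnitAddCircle))
    (measure_ne_top _ _) (ENNReal.ofReal_pos.2 (half_pos hε)).ne'
  have hVm' : (volume : Measure UnitAddCircle).real V ≤
      (volume : Measure UnitAddCircle).real K + ε / 2 := by
    have := ENNReal.toReal_mono (by finiteness) hVm.le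
    rwa [ENNReal.toReal_add (by finiteness) (by finiteness), ENNReal.toReal_ofReal (by positivity)]
      at this
  obtain ⟨f, hf0, hf1, hf⟩ := exists_continuous_zero_one_of_isClosed hV.isClosed_compl hK
    (Set.disjoint_compl_left_iff_subset.2 hKV)
  have hint : ∫ x : UnitAddCircle, f x ≤ (volume : Measure UnitAddCircle).real V := by
    rw [← integral_indicator_one hV.measurableSet]
    refine integral_mono_of_nonneg (Eventually.of_forall fun x => (hf x).1)
      ((integrable_const 1).indicator hV.measurableSet) (Eventually.of_forall fun x => ?_)
    by_cases hx : x ∈ V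
    · simpa [hx] using (hf x).2
    · simpa [hx] using (hf0 hx).le
  filter_upwards [(tendsto_average_orbit_real f).eventually
    (eventually_lt_nhds (b := (∫ x : UnitAddCircle, f x) + ε / 2) (by linarith)),
    eventually_gt_atTop 0] with N hN hN0
  have hN' : (0 : ℝ) < N := by exact_mod_cast hN0
  rw [ncard_preimage_orbit]
  rw [inv_mul_lt_iff₀ hN'] at hN
  calc _ ≤ ∑ n ∈ Finset.Icc 1 N, f (orbit n) := by
        refine Finset.sum_le_sum fun n _ => ?_
        by_cases hx : orbit n ∈ K
        · simpa [hx] using (hf1 hx).ge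
        · simpa [hx] using (hf _).1
    _ ≤ _ := hN.le
    _ ≤ N * ((volume : Measure UnitAddCircle).real K + ε) :=
        mul_le_mul_of_nonneg_left (by linarith) hN'.le
    _ = _ := mul_comm _ _

lemma asympDensityGE_preimage_orbit {V : Set UnitAddCircle} (hV : IsOpen V) :
    AsympDensityGE (orbit ⁻¹' V) ((volume : Measure UnitAddCircle).real V) := by
  intro ε hε
  filter_upwards [asympDensityLE_preimage_orbit hV.isClosed_compl ε hε] with N hN
  have h1 : (((orbit ⁻¹' V) ∩ Set.Icc 1 N).ncard : ℝ) +
      ((orbit ⁻¹' Vᶜ) ∩ Set.Icc 1 N).ncard = N := by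
    rw [ncard_preimage_orbit, ncard_preimage_orbit, ← Finset.sum_add_distrib]
    calc _ = ∑ n ∈ Finset.Icc 1 N, (1 : ℝ) := Finset.sum_congr rfl fun n _ => by
          by_cases hx : orbit n ∈ V <;> simp [hx]
      _ = N := by simp
  rw [measureReal_compl hV.measurableSet, measureReal_def (s := Set.univ),
    UnitAddCircle.measure_univ, ENNReal.toReal_one] at hN
  linarith

lemma frequently_orbit_mem {V : Set UnitAddCircle} (hV : IsOpen V) (hne : V.Nonempty) :
    ∃ᶠ n in atTop, orbit n ∈ V := by
  intro h
  obtain ⟨M, hM⟩ := eventually_atTop.1 h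
  have hpos : 0 < (volume : Measure UnitAddCircle).real V :=
    ENNReal.toReal_pos (hV.measure_pos _ hne).ne' (measure_ne_top _ _)
  obtain ⟨N, hN, hN2⟩ := ((asympDensityGE_preimage_orbit hV _ (half_pos hpos)).and
    ((tendsto_natCast_atTop_atTop (R := ℝ)).eventually_gt_atTop
      (2 * M / (volume : Measure UnitAddCircle).real V))).exists
  have h3 : ((orbit ⁻¹' V) ∩ Set.Icc 1 N).ncard ≤ M := by
    refine (Set.ncard_le_ncard (t := Set.Iio M) ?_ (Set.finite_Iio M)).trans (by simp)
    rintro n ⟨hn, -⟩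
    by_contra hc
    exact hM n (not_lt.1 hc) hn
  have h4 : (((orbit ⁻¹' V) ∩ Set.Icc 1 N).ncard : ℝ) ≤ M := by exact_mod_cast h3
  rw [div_lt_iff₀ hpos] at hN2
  linarith

end Equidistribution

/-! ### Lower density bounds from local capture on the circle -/

section Captures

open scoped Pointwise

/-- `B` contains every sufficiently large integer whose orbit point is close to a given point
of `V`. -/
def Captures (B : Set ℕ) (V : Set UnitAddCircle) : Prop :=
  ∀ y ∈ V, ∃ W ∈ 𝓝 y, ∃ M : ℕ, ∀ x ≥ M, orbit x ∈ W → x ∈ B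

lemma Captures.mono {B B' : Set ℕ} {V V' : Set UnitAddCircle} (h : Captures B V) (hB : B ⊆ B')
    (hV : V' ⊆ V) : Captures B' V' := by
  intro y hy
  obtain ⟨W, hW, M, hM⟩ := h y (hV hy)
  exact ⟨W, hW, M, fun x hx hxW => hB (hM x hx hxW)⟩

lemma Captures.union {B : Set ℕ} {V V' : Set UnitAddCircle} (h : Captures B V)
    (h' : Captures B V') : Captures B (V ∪ V') := by
  rintro y (hy | hy)
  exacts [h y hy, h' y hy]

/-- Near u + v, subtract from x a single n ∈ C with orbit point close to u; then x - n is large with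
orbit point close to v. Only one such n is needed, so C may be of density zero or even finite. -/
lemma Captures.add {B C : Set ℕ} {U V : Set UnitAddCircle} (h : Captures B V)
    (hC : U ⊆ closure (orbit '' C)) : Captures (C + B) (U + V) := by
  rintro _ ⟨u, hu, v, hv, rfl⟩
  obtain ⟨W, hW, M, hM⟩ := h v hv
  obtain ⟨O, hOW, hO, hvO⟩ := mem_nhds_iff.1 hW
  have hnear : ∀ᶠ z in 𝓝 u, u + v - z ∈ O := by
    apply ContinuousAt.eventually_mem (f := fun z => u + v - z) (by fun_prop)
    simpa using hO.mem_nhds hvO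
  obtain ⟨_, hz, n, hn, rfl⟩ := mem_closure_iff_nhds.1 (hC hu) _ hnear
  refine ⟨{w | w - orbit n ∈ O}, ?_, M + n, fun x hx hxW => ?_⟩
  · exact (hO.preimage (f := fun w => w - orbit n) (by fun_prop)).mem_nhds hz
  · obtain ⟨d, rfl⟩ := Nat.exists_eq_add_of_le (show n ≤ x by omega)
    refine Set.add_mem_add hn (hM d (by omega) (hOW ?_))
    simpa [map_add] using hxW

lemma Captures.subset_closure {B : Set ℕ} {V : Set UnitAddCircle} (h : Captures B V) :
    V ⊆ closure (orbit '' B) := by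
  intro y hy
  rw [mem_closure_iff_nhds]
  intro W' hW'
  obtain ⟨W, hW, M, hM⟩ := h y hy
  obtain ⟨O, hOW, hO, hyO⟩ := mem_nhds_iff.1 (inter_mem hW hW')
  obtain ⟨n, hn, hnO⟩ := (frequently_atTop.1 (frequently_orbit_mem hO ⟨y, hyO⟩)) M
  exact ⟨orbit n, (hOW hnO).2, n, hM n hn (hOW hnO).1, rfl⟩

lemma Captures.succ_nsmul {B : Set ℕ} {V : Set UnitAddCircle} (h : Captures B V) (i : ℕ) :
    Captures ((i + 1) • B) ((i + 1) • V) := by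
  induction i with
  | zero => simpa using h
  | succ i ih =>
    rw [succ_nsmul' B, succ_nsmul' V]
    exact ih.add h.subset_closure

lemma AsympDensityGE.of_eventually_subset {A B : Set ℕ} {d : ℝ} (hA : AsympDensityGE A d) {M : ℕ}
    (h : ∀ x ≥ M, x ∈ A → x ∈ B) : AsympDensityGE B d := by
  intro ε hε
  filter_upwards [hA (ε / 2) (half_pos hε),
    (tendsto_natCast_atTop_atTop (R := ℝ)).eventually_ge_atTop (M / (ε / 2))] with N h₁ h₂
  have h₃ : (A ∩ Set.Icc 1 N).ncard ≤ (B ∩ Set.Icc 1 N).ncard + M := by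
    refine (Set.ncard_le_ncard (t := (B ∩ Set.Icc 1 N) ∪ Set.Iio M) ?_ ?_).trans
      ((Set.ncard_union_le _ _).trans (by simp))
    · rintro n ⟨hn, hN⟩
      rcases lt_or_ge n M with hM | hM
      · exact Or.inr hM
      · exact Or.inl ⟨h n hM hn, hN⟩
    · exact ((Set.finite_Icc 1 N).subset Set.inter_subset_right).union (Set.finite_Iio M)
  have h₄ : ((A ∩ Set.Icc 1 N).ncard : ℝ) ≤ (B ∩ Set.Icc 1 N).ncard + M := by exact_mod_cast h₃
  rw [div_le_iff₀ (half_pos hε)] at h₂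
  linarith

/-- Compactness makes the local thresholds M uniform. -/
lemma Captures.exists_isOpen {B : Set ℕ} {V K : Set UnitAddCircle} (h : Captures B V)
    (hK : IsCompact K) (hKV : K ⊆ V) :
    ∃ O, IsOpen O ∧ K ⊆ O ∧ ∃ M : ℕ, ∀ x ≥ M, orbit x ∈ O → x ∈ B := by
  refine hK.induction_on (p := fun S => ∃ O, IsOpen O ∧ S ⊆ O ∧ ∃ M : ℕ, ∀ x ≥ M,
    orbit x ∈ O → x ∈ B) ⟨∅, isOpen_empty, subset_rfl, 0, by simp⟩ ?_ ?_ ?_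
  · rintro s t hst ⟨O, hO, htO, hM⟩
    exact ⟨O, hO, hst.trans htO, hM⟩
  · rintro s t ⟨O, hO, hs, M, hM⟩ ⟨O', hO', ht, M', hM'⟩
    refine ⟨O ∪ O', hO.union hO', Set.union_subset_union hs ht, max M M', fun x hx hxO => ?_⟩
    rcases hxO with hxO | hxO
    · exact hM x ((le_max_left _ _).trans hx) hxO
    · exact hM' x ((le_max_right _ _).trans hx) hxO
  · intro y hy
    obtain ⟨W, hW, M, hM⟩ := h y (hKV hy)
    exact ⟨interior W, mem_nhdsWithin_of_mem_nhds (interior_mem_nhds.2 hW), interior W,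
      isOpen_interior, subset_rfl, M, fun x hx hxW => hM x hx (interior_subset hxW)⟩

lemma Captures.asympDensityGE {B : Set ℕ} {V : Set UnitAddCircle} (h : Captures B V)
    (hV : IsOpen V) : AsympDensityGE B ((volume : Measure UnitAddCircle).real V) := by
  refine .of_forall_lt fun d hd => ?_
  rcases lt_or_ge d 0 with hd0 | hd0
  · intro ε hε
    filter_upwards [asympDensityGE_zero B ε hε] with N hN
    exact (mul_le_mul_of_nonneg_right (by linarith) N.cast_nonneg).trans hN
  · obtain ⟨K, hKV, hK, hdK⟩ := hV.exists_lt_isCompact (μ := (volume : Measure UnitAddCircle))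
      ((ENNReal.ofReal_lt_iff_lt_toReal hd0 (measure_ne_top _ _)).2 hd)
    obtain ⟨O, hO, hKO, M, hM⟩ := h.exists_isOpen hK hKV
    have hdO : d ≤ (volume : Measure UnitAddCircle).real O :=
      ((ENNReal.ofReal_le_iff_le_toReal (measure_ne_top _ _)).1 hdK.le).trans
        (measureReal_mono hKO)
    have hge := (asympDensityGE_preimage_orbit hO).of_eventually_subset hM
    intro ε hε
    filter_upwards [hge ε hε] with N hN
    exact (mul_le_mul_of_nonneg_right (by linarith) N.cast_nonneg).trans hN

/-- A quantitative form of density of the orbit: boundedly many steps come close to every point.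
This bounds the corrections needed in `captures_thinBasis`. -/
lemma exists_orbit_dist_lt {δ : ℝ} (hδ : 0 < δ) :
    ∃ R : ℕ, ∀ z : UnitAddCircle, ∃ r ≤ R, dist (orbit r) z < δ := by
  obtain ⟨t, ht⟩ := isCompact_univ.elim_finite_subcover
    (fun r : ℕ => Metric.ball (orbit r) δ) (fun r => Metric.isOpen_ball) (fun z _ => by
      obtain ⟨n, hn⟩ := (frequently_orbit_mem (Metric.isOpen_ball (x := z) (ε := δ))
        ⟨z, Metric.mem_ball_self hδ⟩).exists
      exact Set.mem_iUnion.2 ⟨n, by rwa [Metric.mem_ball, dist_comm]⟩)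
  refine ⟨t.sup id, fun z => ?_⟩
  obtain ⟨r, hr, hz⟩ := Set.mem_iUnion₂.1 (ht (Set.mem_univ z))
  exact ⟨r, Finset.le_sup (f := id) hr, by rwa [dist_comm]⟩

end Captures

/-! ### A thin additive basis with steerable orbit points -/

section ThinSets

open scoped Pointwise

/-- The integers whose base-`2 ^ k` digits all lie in `{0, 1}`. -/
inductive IsSparseBinary (k : ℕ) : ℕ → Prop
  | zero : IsSparseBinary k 0
  | step (n b : ℕ) (hb : b < 2) (hn : IsSparseBinary k n) : IsSparseBinary k (2 ^ k * n + b)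

lemma exists_binary_sum (k : ℕ) : ∀ r < 2 ^ k,
    ∃ b : Fin k → ℕ, (∀ j, b j < 2) ∧ ∑ j : Fin k, 2 ^ (j : ℕ) * b j = r := by
  induction k with
  | zero =>
    intro r hr
    exact ⟨fun _ => 0, fun _ => by norm_num, by simp at hr ⊢; omega⟩
  | succ k ih =>
    intro r hr
    obtain ⟨b, hb, hs⟩ := ih (r / 2) (by rw [pow_succ] at hr; omega)
    refine ⟨Fin.cons (r % 2) b, fun j => ?_, ?_⟩
    · refine Fin.cases ?_ (fun j => ?_) j
      · simpa using Nat.mod_lt r two_pos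
      · simpa using hb j
    · rw [Fin.sum_univ_succ]
      simp only [Fin.val_zero, pow_zero, Fin.cons_zero, one_mul, Fin.val_succ, Fin.cons_succ,
        pow_succ', mul_assoc, ← Finset.mul_sum, hs]
      omega

/-- Each base-2^k digit of x is split into its k bits, and s j collects the j-th bits of all the
digits. -/
lemma exists_sparseBinary_sum {k : ℕ} (hk : 1 ≤ k) (x : ℕ) :
    ∃ s : Fin k → ℕ, (∀ j, IsSparseBinary k (s j)) ∧ ∑ j : Fin k, 2 ^ (j : ℕ) * s j = x := by
  induction x using Nat.strong_induction_on with
  | _ x ih =>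
    rcases Nat.eq_zero_or_pos x with rfl | hx
    · exact ⟨fun _ => 0, fun _ => .zero, by simp⟩
    · have h2 : 1 < 2 ^ k := Nat.one_lt_two_pow (by omega)
      obtain ⟨s, hs, hsum⟩ := ih (x / 2 ^ k) (Nat.div_lt_self hx h2)
      obtain ⟨b, hb, hbsum⟩ := exists_binary_sum k (x % 2 ^ k) (Nat.mod_lt _ (by positivity))
      refine ⟨fun j => 2 ^ k * s j + b j, fun j => .step _ _ (hb j) (hs j), ?_⟩
      simp only [mul_add, Finset.sum_add_distrib, hbsum]
      rw [Finset.sum_congr rfl fun j _ => mul_left_comm _ _ _, ← Finset.mul_sum, hsum]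
      exact Nat.div_add_mod _ _

lemma ncard_sparseBinary_le (k m : ℕ) :
    {n | IsSparseBinary k n ∧ n < 2 ^ (k * m)}.Finite ∧
      {n | IsSparseBinary k n ∧ n < 2 ^ (k * m)}.ncard ≤ 2 ^ m := by
  refine ⟨(Set.finite_Iio (2 ^ (k * m))).subset fun n hn => hn.2, ?_⟩
  induction m with
  | zero =>
    refine (Set.ncard_le_ncard (t := {0}) ?_ (by simp)).trans (by simp)
    rintro n ⟨-, hn⟩
    simpa using hn
  | succ m ih =>
    have hfin : ({n | IsSparseBinary k n ∧ n < 2 ^ (k * m)} ×ˢ Set.Iio 2).Finite :=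
      ((Set.finite_Iio (2 ^ (k * m))).subset fun n hn => hn.2).prod (Set.finite_Iio 2)
    refine (Set.ncard_le_ncard (t := (fun p : ℕ × ℕ => 2 ^ k * p.1 + p.2) ''
      ({n | IsSparseBinary k n ∧ n < 2 ^ (k * m)} ×ˢ Set.Iio 2)) ?_ (hfin.image _)).trans
      ((Set.ncard_image_le hfin).trans ?_)
    · rintro n ⟨hn, hlt⟩
      cases hn with
      | zero => exact ⟨(0, 0), ⟨⟨.zero, by positivity⟩, by simp⟩, by simp⟩
      | step n b hb hn =>
        refine ⟨(n, b), ⟨⟨hn, ?_⟩, hb⟩, rfl⟩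
        rw [mul_add, mul_one, pow_add, mul_comm] at hlt
        have : n * 2 ^ k < 2 ^ (k * m) * 2 ^ k := by linarith [mul_comm n (2 ^ k), Nat.zero_le b]
        exact Nat.lt_of_mul_lt_mul_right this
    · rw [Set.ncard_prod, pow_succ]
      exact Nat.mul_le_mul ih (by simp)

/-- The number of elements of `A` up to `N` is `O(N ^ (1 / k) * (log N) ^ 2)`. -/
def IsThin (k : ℕ) (A : Set ℕ) : Prop :=
  ∃ D : ℕ, ∀ m N : ℕ, N < 2 ^ (k * m) → (A ∩ Set.Iic N).ncard ≤ D * (m + 1) ^ 2 * 2 ^ m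

lemma IsThin.union_finite {k : ℕ} {A F : Set ℕ} (hA : IsThin k A) (hF : F.Finite) :
    IsThin k (A ∪ F) := by
  obtain ⟨D, hD⟩ := hA
  refine ⟨D + F.ncard, fun m N hN => ?_⟩
  have h1 : ((A ∪ F) ∩ Set.Iic N).ncard ≤ (A ∩ Set.Iic N).ncard + F.ncard := by
    rw [Set.union_inter_distrib_right]
    exact (Set.ncard_union_le _ _).trans
      (Nat.add_le_add_left (Set.ncard_le_ncard Set.inter_subset_left hF) _)
  have h2 : F.ncard ≤ F.ncard * ((m + 1) ^ 2 * 2 ^ m) := Nat.le_mul_of_pos_right _ (by positivity)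
  calc _ ≤ _ := h1
    _ ≤ D * (m + 1) ^ 2 * 2 ^ m + F.ncard * ((m + 1) ^ 2 * 2 ^ m) := Nat.add_le_add (hD m N hN) h2
    _ = _ := by ring

/-- With N ≈ 2^(kl), there are at most (polynomial in l)·2^(li) sums of i elements up to N; since i
≤ k - 1, the missing factor 2^l beats the polynomial. -/
lemma IsThin.asympDensityLE_nsmul {k i : ℕ} {A : Set ℕ} (hA : IsThin k A) (hi : i < k) :
    AsympDensityLE (i • A) 0 := by
  obtain ⟨D, hD⟩ := hA
  intro ε hε
  have hlim : Tendsto (fun m : ℕ => ((D + 1 : ℕ) : ℝ) ^ k * 2 ^ k * 2 ^ (2 * k) *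
      ((m : ℝ) ^ (2 * k) / 2 ^ m)) atTop (𝓝 0) := by
    have := (tendsto_pow_const_div_const_pow_of_one_lt (2 * k) (one_lt_two (α := ℝ))).const_mul
      (((D + 1 : ℕ) : ℝ) ^ k * 2 ^ k * 2 ^ (2 * k))
    rwa [mul_zero] at this
  obtain ⟨m₀, hm₀⟩ := eventually_atTop.1 (hlim.eventually (eventually_le_nhds hε))
  filter_upwards [eventually_ge_atTop (2 ^ (k * (m₀ + 1)))] with N hN
  have hk : 0 < k := by omega
  have hN0 : N ≠ 0 := by have : 0 < 2 ^ (k * (m₀ + 1)) := by positivity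
                         omega
  -- the dyadic scale of `N`
  set l := Nat.log 2 N / k with hl
  have hlow : 2 ^ (k * l) ≤ N :=
    (Nat.pow_le_pow_right two_pos (Nat.mul_div_le _ _)).trans (Nat.pow_log_le_self 2 hN0)
  have hup : N < 2 ^ (k * (l + 1)) := by
    refine (Nat.lt_pow_succ_log_self one_lt_two N).trans_le (Nat.pow_le_pow_right two_pos ?_)
    exact Nat.lt_mul_div_succ (Nat.log 2 N) hk
  have hlm : m₀ ≤ l := by
    by_contra hcon
    have : 2 ^ (k * (l + 1)) ≤ 2 ^ (k * (m₀ + 1)) :=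
      Nat.pow_le_pow_right two_pos (Nat.mul_le_mul_left _ (by omega))
    omega
  have hcount : ((i • A) ∩ Set.Icc 1 N).ncard ≤
      ((D + 1) * (2 * (l + 1)) ^ 2 * 2 ^ (l + 1)) ^ i := by
    refine (Set.ncard_le_ncard (t := (i • A) ∩ Set.Iic N)
      (Set.inter_subset_inter_right _ fun x hx => hx.2) (finite_inter_Iic _ _)).trans ?_
    refine (ncard_nsmul_inter_Iic_le A N i).trans (Nat.pow_le_pow_left ?_ i)
    refine (hD _ _ hup).trans ?_
    gcongr <;> omega
  -- The spare factor 2^(l+1) on the left is affordable because i + 1 ≤ k.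
  have hbound : (((D + 1) * (2 * (l + 1)) ^ 2 * 2 ^ (l + 1)) ^ i) * 2 ^ (l + 1) ≤
      (D + 1) ^ k * 2 ^ (2 * k) * (l + 1) ^ (2 * k) * (2 ^ k * 2 ^ (k * l)) := by
    calc _ = ((D + 1) * (2 * (l + 1)) ^ 2) ^ i * (2 ^ (l + 1)) ^ (i + 1) := by
          rw [mul_pow _ (2 ^ (l + 1)), pow_succ (2 ^ (l + 1))]; ring
      _ ≤ ((D + 1) * (2 * (l + 1)) ^ 2) ^ k * (2 ^ (l + 1)) ^ k :=
          Nat.mul_le_mul (Nat.pow_le_pow_right (by positivity) hi.le)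
            (Nat.pow_le_pow_right (by positivity) hi)
      _ = _ := by rw [mul_pow, ← pow_mul, ← pow_mul, mul_pow]; ring
  have hε' := hm₀ (l + 1) (by omega)
  have hcount' : (((i • A) ∩ Set.Icc 1 N).ncard : ℝ) ≤
      (((D + 1) * (2 * (l + 1)) ^ 2 * 2 ^ (l + 1)) ^ i : ℕ) := by exact_mod_cast hcount
  have hbound' : ((((D + 1) * (2 * (l + 1)) ^ 2 * 2 ^ (l + 1)) ^ i : ℕ) : ℝ) * 2 ^ (l + 1) ≤
      ((D + 1 : ℕ) : ℝ) ^ k * 2 ^ (2 * k) * ((l + 1 : ℕ) : ℝ) ^ (2 * k) *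
        (2 ^ k * 2 ^ (k * l)) := by exact_mod_cast hbound
  have hlow' : (2 : ℝ) ^ (k * l) ≤ N := by exact_mod_cast hlow
  have h2 : (0 : ℝ) < 2 ^ (l + 1) := by positivity
  rw [← mul_div_assoc, div_le_iff₀ h2] at hε'
  refine hcount'.trans (le_of_mul_le_mul_right (hbound'.trans ?_) h2)
  calc _ = ((D + 1 : ℕ) : ℝ) ^ k * 2 ^ k * 2 ^ (2 * k) * ((l + 1 : ℕ) : ℝ) ^ (2 * k) *
        2 ^ (k * l) := by ring
    _ ≤ (ε * 2 ^ (l + 1)) * N := by gcongr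
    _ = _ := by ring

/-- The union of a thin additive basis of order `k` shifted by a sparse set of corrections. -/
def thinBasis (k : ℕ) : Set ℕ :=
  {n | ∃ j < k, ∃ s, IsSparseBinary k s ∧ ∃ R, ∃ r ≤ R, n = 2 ^ j * s + (2 ^ R + r)}

lemma isThin_thinBasis {k : ℕ} : IsThin k (thinBasis k) := by
  refine ⟨k * k ^ 2, fun m N hN => ?_⟩
  obtain ⟨hfin, hcard⟩ := ncard_sparseBinary_le k m
  set S := {n | IsSparseBinary k n ∧ n < 2 ^ (k * m)} with hS
  have hfin' : (Set.Iio k ×ˢ (S ×ˢ (Set.Iio (k * m) ×ˢ Set.Iio (k * m)))).Finite :=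
    (Set.finite_Iio k).prod (hfin.prod ((Set.finite_Iio _).prod (Set.finite_Iio _)))
  refine (Set.ncard_le_ncard (t := (fun p : ℕ × ℕ × ℕ × ℕ =>
    2 ^ p.1 * p.2.1 + (2 ^ p.2.2.1 + p.2.2.2)) ''
      (Set.Iio k ×ˢ (S ×ˢ (Set.Iio (k * m) ×ˢ Set.Iio (k * m))))) ?_ (hfin'.image _)).trans
    ((Set.ncard_image_le hfin').trans ?_)
  · rintro _ ⟨⟨j, hj, s, hs, R, r, hr, rfl⟩, hle⟩
    have hle' : 2 ^ j * s + (2 ^ R + r) < 2 ^ (k * m) := lt_of_le_of_lt hle hN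
    -- The term 2^R forces R to be at most logarithmic in N, and r ≤ R then as well. This is why the
    -- corrections cost only the factor (log N)^2.
    have hR : R < k * m := (Nat.pow_lt_pow_iff_right one_lt_two).1 (by omega)
    have hR0 : 0 < 2 ^ R := by positivity
    have hs' : s ≤ 2 ^ j * s := Nat.le_mul_of_pos_left _ (by positivity)
    exact ⟨(j, s, R, r), ⟨hj, ⟨hs, by change s < 2 ^ (k * m); omega⟩, hR, lt_of_le_of_lt hr hR⟩, rfl⟩
  · simp only [Set.ncard_prod]
    have h1 : ∀ n : ℕ, (Set.Iio n).ncard = n := by simp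
    simp only [h1]
    calc k * (S.ncard * (k * m * (k * m))) ≤ k * (2 ^ m * (k * (m + 1) * (k * (m + 1)))) := by
          gcongr <;> omega
      _ = _ := by ring

lemma norm_sum_fin_le {G : Type*} [SeminormedAddCommGroup G] {k : ℕ} (f : Fin k → G) {c : ℝ}
    (h : ∀ j, ‖f j‖ ≤ c) : ‖∑ j, f j‖ ≤ k * c := by
  simpa using norm_sum_le_of_le Finset.univ fun j _ => h j

/-- A large x with orbit point near ∑ u j is decomposed by the digit basis. Corrections then move
the orbit points of all summands but the last near the u j, and the last absorbs the remainder so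
that the total is still x. Its orbit point is automatically near its target, because the orbit
points of the whole sum and of the other summands are near theirs. -/
lemma captures_thinBasis {k : ℕ} (hk : 1 ≤ k) {U : Set UnitAddCircle} (hU : IsOpen U) :
    Captures (k • (thinBasis k ∩ orbit ⁻¹' U)) (k • U) := by
  obtain ⟨k, rfl⟩ := Nat.exists_eq_add_of_le' hk
  rw [← kSumset_eq_nsmul, ← kSumset_eq_nsmul]
  rintro _ ⟨u, hu, rfl⟩
  obtain ⟨ε, hε, hball⟩ : ∃ ε > 0, ∀ j, Metric.ball (u j) ε ⊆ U := by
    have hev : ∀ᶠ ε in 𝓝[>] (0 : ℝ), ∀ j, Metric.ball (u j) ε ⊆ U := by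
      refine eventually_all.2 fun j => ?_
      obtain ⟨ε, hε, hb⟩ := Metric.isOpen_iff.1 hU _ (hu j)
      filter_upwards [Ioc_mem_nhdsGT hε] with ε' hε'
      exact (Metric.ball_subset_ball hε'.2).trans hb
    obtain ⟨ε, hε, hpos⟩ := (hev.and self_mem_nhdsWithin).exists
    exact ⟨ε, hpos, hε⟩
  have hδ : 0 < ε / (k + 1) := by positivity
  obtain ⟨R₀, hR₀⟩ := exists_orbit_dist_lt hδ
  -- From here on there are k + 1 summands. The k free corrections are at most R₀ each, so R bounds
  -- their sum and the last one can be R - ∑ r j ≥ 0. All corrections together then contribute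
  -- exactly (k + 1)·2^R + R, a constant subtracted from x before the digits are taken.
  set R := k * R₀
  refine ⟨Metric.ball (∑ j, u j) (ε / (k + 1)), Metric.ball_mem_nhds _ hδ,
    (k + 1) * 2 ^ R + R, fun x hx hxW => ?_⟩
  obtain ⟨s, hs, hsum⟩ := exists_sparseBinary_sum (Nat.le_add_left 1 k) (x - ((k + 1) * 2 ^ R + R))
  choose r hr hrd using fun j : Fin k =>
    hR₀ (u j.castSucc - orbit (2 ^ (j : ℕ) * s j.castSucc + 2 ^ R))
  have hrR : ∑ j, r j ≤ R := by
    simpa using Finset.sum_le_sum fun j (_ : j ∈ Finset.univ) => hr j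
  let e : Fin (k + 1) → ℕ := Fin.snoc (α := fun _ => ℕ) r (R - ∑ j, r j)
  have heR : ∀ j, e j ≤ R := by
    refine Fin.lastCases ?_ (fun j => ?_)
    · simp [e]
    · simp only [e, Fin.snoc_castSucc]
      exact (Finset.single_le_sum (fun _ _ => Nat.zero_le _) (Finset.mem_univ j)).trans hrR
  have hesum : ∑ j, e j = R := by
    simp only [e, Fin.sum_univ_castSucc, Fin.snoc_castSucc, Fin.snoc_last]
    omega
  let a : Fin (k + 1) → ℕ := fun j => 2 ^ (j : ℕ) * s j + (2 ^ R + e j)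
  have hasum : ∑ j, a j = x := by
    simp only [a, Finset.sum_add_distrib, hsum, hesum]
    simp
    omega
  have hclose : ∀ j : Fin k, dist (orbit (a j.castSucc)) (u j.castSucc) < ε / (k + 1) := by
    intro j
    have := hrd j
    rw [dist_eq_norm] at this ⊢
    simp only [a, e, Fin.snoc_castSucc, map_add, Fin.val_castSucc] at this ⊢
    convert this using 2
    abel
  have hlast : dist (orbit (a (Fin.last k))) (u (Fin.last k)) < ε := by
    have h1 : orbit (a (Fin.last k)) - u (Fin.last k) = (orbit x - ∑ j, u j) -
        ∑ j : Fin k, (orbit (a j.castSucc) - u j.castSucc) := by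
      rw [← hasum, map_sum, Fin.sum_univ_castSucc, Fin.sum_univ_castSucc, Finset.sum_sub_distrib]
      abel
    rw [dist_eq_norm, h1]
    have h2 : ‖∑ j : Fin k, (orbit (a j.castSucc) - u j.castSucc)‖ ≤ k * (ε / (k + 1)) := by
      refine norm_sum_fin_le _ fun j => ?_
      rw [← dist_eq_norm]
      exact (hclose j).le
    rw [Metric.mem_ball, dist_eq_norm] at hxW
    calc _ ≤ _ := norm_sub_le _ _
      _ < ε / (k + 1) + k * (ε / (k + 1)) := by linarith
      _ = ε := by field_simp; ring
  refine ⟨a, fun j => ⟨⟨j, j.2, s j, hs j, R, e j, heR j, rfl⟩, hball j ?_⟩, hasum⟩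
  rw [Metric.mem_ball]
  refine Fin.lastCases hlast (fun j => ?_) j
  refine (hclose j).trans_le (div_le_self hε.le ?_)
  linarith [k.cast_nonneg (α := ℝ)]

/-- The corrections 2^R + r alone (s = 0) suffice: for R large, some r ≤ R steers the orbit point
next to y. -/
lemma subset_closure_thinBasis {k : ℕ} (hk : 1 ≤ k) {U : Set UnitAddCircle} (hU : IsOpen U) :
    U ⊆ closure (orbit '' (thinBasis k ∩ orbit ⁻¹' U)) := by
  intro y hy
  rw [Metric.mem_closure_iff]
  intro ε hε
  obtain ⟨δ, hδ, hb⟩ := Metric.isOpen_iff.1 hU y hy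
  obtain ⟨R, hR⟩ := exists_orbit_dist_lt (lt_min hε hδ)
  obtain ⟨r, hr, hd⟩ := hR (y - orbit (2 ^ R))
  have hd' : dist (orbit (2 ^ R + r)) y < min ε δ := by
    rw [dist_eq_norm] at hd ⊢
    rw [map_add]
    convert hd using 2
    abel
  refine ⟨orbit (2 ^ R + r), ⟨2 ^ R + r, ⟨⟨0, hk, 0, .zero, R, r, hr, by simp⟩, hb ?_⟩, rfl⟩, ?_⟩
  · exact hd'.trans_le (min_le_right _ _)
  · rw [dist_comm]
    exact hd'.trans_le (min_le_left _ _)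

lemma one_le_of_mem_thinBasis {k n : ℕ} (hn : n ∈ thinBasis k) : 1 ≤ n := by
  obtain ⟨j, -, s, -, R, r, -, rfl⟩ := hn
  have : 0 < 2 ^ R := by positivity
  omega

lemma IsThin.mono {k : ℕ} {A B : Set ℕ} (hB : IsThin k B) (h : A ⊆ B) : IsThin k A := by
  obtain ⟨D, hD⟩ := hB
  exact ⟨D, fun m N hN => (Set.ncard_le_ncard (Set.inter_subset_inter_left _ h)
    (finite_inter_Iic _ _)).trans (hD m N hN)⟩

end ThinSets

/-! ### Arcs of the circle: sumsets, translates, measures -/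

section Arcs

open scoped Pointwise

/-- The open arc of the circle which is the image of the interval `(a, b)`. -/
def openArc (a b : ℝ) : Set UnitAddCircle := (fun x : ℝ => (x : UnitAddCircle)) '' Set.Ioo a b

/-- The closed arc of the circle which is the image of the interval `[a, b]`. -/
def closedArc (a b : ℝ) : Set UnitAddCircle := (fun x : ℝ => (x : UnitAddCircle)) '' Set.Icc a b

lemma isOpen_openArc (a b : ℝ) : IsOpen (openArc a b) :=
  QuotientAddGroup.isOpenMap_coe _ isOpen_Ioo

lemma isCompact_closedArc (a b : ℝ) : IsCompact (closedArc a b) :=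
  isCompact_Icc.image (AddCircle.continuous_mk' 1)

lemma openArc_subset_closedArc (a b : ℝ) : openArc a b ⊆ closedArc a b :=
  Set.image_mono Set.Ioo_subset_Icc_self

lemma openArc_mono {a b a' b' : ℝ} (ha : a' ≤ a) (hb : b ≤ b') : openArc a b ⊆ openArc a' b' :=
  Set.image_mono (Set.Ioo_subset_Ioo ha hb)

lemma nsmul_Ioo (i : ℕ) (a b : ℝ) :
    (i + 1) • Set.Ioo a b = Set.Ioo ((i + 1) * a) ((i + 1) * b) := by
  apply subset_antisymm
  · induction i with
    | zero => simp
    | succ i ih =>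
      rw [succ_nsmul]
      refine (Set.add_subset_add_right ih).trans ?_
      rintro _ ⟨x, hx, y, hy, rfl⟩
      simp only [Set.mem_Ioo] at hx hy ⊢
      push_cast
      constructor <;> nlinarith
  · rintro y ⟨hy1, hy2⟩
    have hi : (0 : ℝ) < i + 1 := by positivity
    have : (i + 1) • (y / (i + 1)) ∈ (i + 1) • Set.Ioo a b := by
      refine Set.nsmul_mem_nsmul ⟨?_, ?_⟩
      · rw [lt_div_iff₀ hi]; linarith
      · rw [div_lt_iff₀ hi]; linarith
    rw [nsmul_eq_mul] at this
    push_cast at this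
    rwa [mul_div_cancel₀ _ hi.ne'] at this

lemma nsmul_openArc (i : ℕ) (a b : ℝ) :
    (i + 1) • openArc a b = openArc ((i + 1) * a) ((i + 1) * b) := by
  rw [openArc, openArc, ← nsmul_Ioo]
  exact (Set.image_nsmul (QuotientAddGroup.mk' (AddSubgroup.zmultiples (1 : ℝ))) _ _).symm

lemma coe_add_openArc (t a b : ℝ) :
    {(t : UnitAddCircle)} + openArc a b = openArc (t + a) (t + b) := by
  rw [Set.singleton_add, openArc, openArc, ← Set.image_const_add_Ioo, Set.image_image,
    Set.image_image]
  exact Set.image_congr fun x _ => (AddCircle.coe_add 1 t x).symm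

lemma volume_eq_preimage {S : Set UnitAddCircle} (hS : MeasurableSet S) (a : ℝ) :
    volume S = volume ((fun x : ℝ => (x : UnitAddCircle)) ⁻¹' S ∩ Set.Ioc a (a + 1)) :=
  AddCircle.add_projection_respects_measure 1 a hS

lemma volume_openArc_ge {l : ℝ} (hl : l ≤ 1) (a : ℝ) :
    ENNReal.ofReal l ≤ volume (openArc a (a + l)) := by
  rw [volume_eq_preimage (isOpen_openArc _ _).measurableSet a]
  have hIoo : ENNReal.ofReal l = volume (Set.Ioo a (a + l)) := by simp
  rw [hIoo]
  refine measure_mono fun x hx => ?_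
  exact ⟨Set.mem_image_of_mem _ hx, hx.1, by linarith [hx.2]⟩

lemma volume_closedArc_le (a l : ℝ) :
    volume (closedArc a (a + l)) ≤ ENNReal.ofReal l := by
  rcases lt_or_ge 1 l with hl | hl
  · calc _ ≤ volume (Set.univ : Set UnitAddCircle) := measure_mono (Set.subset_univ _)
      _ = ENNReal.ofReal 1 := by simp
      _ ≤ _ := ENNReal.ofReal_le_ofReal hl.le
  rw [volume_eq_preimage (isCompact_closedArc _ _).measurableSet a]
  calc _ ≤ volume (Set.Icc a (a + l) ∪ {a + 1}) := measure_mono ?_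
    _ ≤ _ := (measure_union_le _ _).trans (by simp)
  rintro x ⟨⟨y, hy, hyx⟩, hx⟩
  rcases hy.1.eq_or_lt with rfl | hay
  -- The class of the left endpoint a is represented in (a, a + 1] by a + 1.
  · right
    refine (AddCircle.coe_eq_coe_iff_of_mem_Ioc (p := (1 : ℝ)) hx
      ⟨by linarith, le_rfl⟩).1 ?_
    exact hyx.symm.trans (AddCircle.coe_add_period 1 a).symm
  · left
    rwa [← (AddCircle.coe_eq_coe_iff_of_mem_Ioc (p := (1 : ℝ)) ⟨hay, by linarith [hy.2]⟩ hx).1 hyx]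

lemma volume_real_closedArc_le {l : ℝ} (hl : 0 ≤ l) (a : ℝ) :
    (volume : Measure UnitAddCircle).real (closedArc a (a + l)) ≤ l :=
  ENNReal.toReal_le_of_le_ofReal hl (volume_closedArc_le a l)

lemma le_volume_real_openArc {l : ℝ} (hl : l ≤ 1) (a : ℝ) :
    l ≤ (volume : Measure UnitAddCircle).real (openArc a (a + l)) :=
  (ENNReal.ofReal_le_iff_le_toReal (measure_ne_top _ _)).1 (volume_openArc_ge hl a)

lemma volume_real_openArc {l : ℝ} (h0 : 0 ≤ l) (hl : l ≤ 1) (a : ℝ) :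
    (volume : Measure UnitAddCircle).real (openArc a (a + l)) = l :=
  ((measureReal_mono (openArc_subset_closedArc _ _)).trans (volume_real_closedArc_le h0 a)).antisymm
    (le_volume_real_openArc hl a)

lemma openArc_eq_univ {a l : ℝ} (hl : 1 < l) : openArc a (a + l) = Set.univ := by
  refine Set.eq_univ_of_forall fun z => ?_
  obtain ⟨x, hx, rfl⟩ : z ∈ (fun x : ℝ => (x : UnitAddCircle)) '' Set.Ioc a (a + 1) := by
    have := AddCircle.coe_image_Ioc_eq (1 : ℝ) a
    exact this ▸ Set.mem_univ z
  exact ⟨x, ⟨hx.1, by linarith [hx.2]⟩, rfl⟩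

end Arcs

/-! ### Part (a): prescribing the last two densities -/

section ThinDensities

open scoped Pointwise

lemma AsympDensityLE.le {A : Set ℕ} {d d' : ℝ} (h : AsympDensityLE A d) (hd : d ≤ d') :
    AsympDensityLE A d' := by
  intro ε hε
  filter_upwards [h ε hε] with N hN
  exact hN.trans (mul_le_mul_of_nonneg_right (by linarith) N.cast_nonneg)

lemma AsympDensityGE.le {A : Set ℕ} {d d' : ℝ} (h : AsympDensityGE A d) (hd : d' ≤ d) :
    AsympDensityGE A d' := by
  intro ε hε
  filter_upwards [h ε hε] with N hN
  exact (mul_le_mul_of_nonneg_right (by linarith) N.cast_nonneg).trans hN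

lemma Captures.hasAsympDensity {B Z : Set ℕ} {V K : Set UnitAddCircle} {d : ℝ}
    (h : Captures B V) (hV : IsOpen V) (hK : IsClosed K) (hZ : AsympDensityLE Z 0)
    (hB : B ⊆ orbit ⁻¹' K ∪ Z) (hVd : d ≤ (volume : Measure UnitAddCircle).real V)
    (hKd : (volume : Measure UnitAddCircle).real K ≤ d) : HasAsympDensity B d :=
  hasAsympDensity_of_le_of_ge
    (((asympDensityLE_preimage_orbit hK).of_subset_union hZ hB).le hKd)
    ((h.asympDensityGE hV).le hVd)

lemma isOpen_succ_nsmul {U : Set UnitAddCircle} (hU : IsOpen U) (i : ℕ) :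
    IsOpen ((i + 1) • U) := by
  rw [succ_nsmul]
  exact hU.add_left

/-- Given an open set `U` and a finite set `F`, there is a set of integers whose `i`-fold sumsets
are null for `i < k`, whose `k`-fold sumset is modelled on `kU` and whose `(k + 1)`-fold sumset is
modelled on the union of `(k + 1)U` and the translates of `kU` by the orbit points of `F`. -/
lemma exists_thin_hasAsympDensity {k : ℕ} (hk : 1 ≤ k) {U : Set UnitAddCircle} (hU : IsOpen U)
    {F : Set ℕ} (hF : F.Finite) (hF1 : ∀ n ∈ F, 1 ≤ n) {K : Set UnitAddCircle} (hK : IsClosed K)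
    {β : ℝ} (hUK : k • U ⊆ K) (hβ : β ≤ (volume : Measure UnitAddCircle).real (k • U))
    (hKβ : (volume : Measure UnitAddCircle).real K ≤ β) :
    ∃ A : Set ℕ, (∀ n ∈ A, 1 ≤ n) ∧ (∀ i, i < k → HasAsympDensity (i • A) 0) ∧
      HasAsympDensity (k • A) β ∧
      ∀ (K' : Set UnitAddCircle) (γ : ℝ), IsClosed K' →
        (k + 1) • U ∪ (orbit '' F + k • U) ⊆ K' →
        γ ≤ (volume : Measure UnitAddCircle).real ((k + 1) • U ∪ (orbit '' F + k • U)) →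
        (volume : Measure UnitAddCircle).real K' ≤ γ → HasAsympDensity ((k + 1) • A) γ := by
  set A₀ := thinBasis k ∩ orbit ⁻¹' U with hA₀
  have hthin : IsThin k (A₀ ∪ F) :=
    (isThin_thinBasis.mono Set.inter_subset_left).union_finite hF
  have hpre : ∀ i : ℕ, i • A₀ ⊆ orbit ⁻¹' (i • U) := nsmul_subset_preimage orbit Set.inter_subset_right
  have hcap : Captures (k • A₀) (k • U) := captures_thinBasis hk hU
  have hkU : IsOpen (k • U) := by
    obtain ⟨k, rfl⟩ := Nat.exists_eq_add_of_le' hk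
    exact isOpen_succ_nsmul hU k
  have hnull : ∀ i, i < k → AsympDensityLE (i • (A₀ ∪ F)) 0 :=
    fun i hi => hthin.asympDensityLE_nsmul hi
  -- Sums of k elements that use F lie in this set, which is null because only k - 1 summands are
  -- unrestricted.
  have hZ : AsympDensityLE ((k - 1) • (A₀ ∪ F) + F) 0 := (hnull _ (by omega)).add_finite hF
  have hsub : k • (A₀ ∪ F) ⊆ k • A₀ ∪ ((k - 1) • (A₀ ∪ F) + F) := by
    obtain ⟨k, rfl⟩ := Nat.exists_eq_add_of_le' hk
    exact succ_nsmul_union_subset k A₀ F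
  have hmono : ∀ i : ℕ, i • A₀ ⊆ i • (A₀ ∪ F) := fun i =>
    Set.nsmul_subset_nsmul_left Set.subset_union_left
  refine ⟨A₀ ∪ F, ?_, fun i hi => ?_, ?_, fun K' γ hK' hUK' hγ hKγ => ?_⟩
  · rintro n (hn | hn)
    exacts [one_le_of_mem_thinBasis hn.1, hF1 n hn]
  · exact hasAsympDensity_of_le_of_ge (hnull i hi) (asympDensityGE_zero _)
  · exact (hcap.mono (hmono k) subset_rfl).hasAsympDensity hkU hK hZ
      (hsub.trans (Set.union_subset_union_left _ ((hpre k).trans (Set.preimage_mono hUK)))) hβ hKβ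
  · have hcap₁ : Captures ((k + 1) • (A₀ ∪ F)) ((k + 1) • U) := by
      refine (hcap.add (subset_closure_thinBasis hk hU)).mono ?_ (succ_nsmul' U k).subset
      exact (succ_nsmul' A₀ k).symm.subset.trans (hmono _)
    have hcap₂ : Captures ((k + 1) • (A₀ ∪ F)) (orbit '' F + k • U) := by
      refine (hcap.add (C := F) subset_closure).mono ?_ subset_rfl
      rw [succ_nsmul']
      exact Set.add_subset_add Set.subset_union_right (hmono k)
    refine (hcap₁.union hcap₂).hasAsympDensity ((isOpen_succ_nsmul hU k).union hkU.add_left) hK'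
      (hZ.add_finite hF) ?_ hγ hKγ
    refine (succ_nsmul_union_subset k A₀ F).trans (Set.union_subset ?_ ?_)
    · exact ((hpre (k + 1)).trans (Set.preimage_mono
        (Set.subset_union_left.trans hUK'))).trans Set.subset_union_left
    -- A sum with a summand from F is an element of k(A₀ ∪ F) plus one of F: either it lies over the
    -- translates of kU, or it belongs to the null set plus a finite set.
    · refine (Set.add_subset_add_right hsub).trans ?_
      rw [Set.union_add]
      refine Set.union_subset_union_left _ ?_
      rintro _ ⟨a, ha, f, hf, rfl⟩
      refine hUK' (Or.inr ?_)
      rw [map_add, add_comm (orbit a)]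
      exact Set.add_mem_add (Set.mem_image_of_mem _ hf) (hpre k ha)

/-- The long arc has three parts: a left end covered by the arc of length L, a right end covered by
the translate by `orbit 1`, and a compact middle covered by finitely many translates contained in
the long arc. The value of c makes the translate by `orbit 1` end exactly where the long arc ends.
-/
lemma exists_finite_translates {c β L γ : ℝ} (k : ℕ) (hc : c = √2 - γ + β) (hβ : 0 < β)
    (hβγ : β < γ) (hL : 0 < L) :
    ∃ F : Set ℕ, F.Finite ∧ (∀ n ∈ F, 1 ≤ n) ∧
      orbit '' F + openArc (k * c) (k * c + β) ⊆ openArc ((k + 1) * c) ((k + 1) * c + γ) ∧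
      openArc ((k + 1) * c) ((k + 1) * c + γ) ⊆ openArc ((k + 1) * c) ((k + 1) * c + L) ∪
        (orbit '' F + openArc (k * c) (k * c + β)) := by
  set V := openArc (k * c) (k * c + β) with hV
  set p := (k + 1) * c with hp
  have htrans : ∀ v t : ℝ, t = c + v → {(t : UnitAddCircle)} + V = openArc (p + v) (p + v + β) := by
    rintro v t rfl
    rw [hV, coe_add_openArc]
    congr 1 <;> rw [hp] <;> ring
  let T : Set ℕ := {t | 1 ≤ t ∧ {orbit t} + V ⊆ openArc p (p + γ)}
  have hone : {orbit 1} + V = openArc (p + (γ - β)) (p + γ) := by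
    rw [orbit_apply, one_nsmul, htrans (γ - β) √2 (by rw [hc]; ring)]
    congr 1; ring
  have hT1 : 1 ∈ T := ⟨le_rfl, by rw [hone]; exact openArc_mono (by linarith) le_rfl⟩
  have hcover : closedArc (p + L) (p + (γ - β)) ⊆ ⋃ t ∈ T, ({orbit t} + V) := by
    rintro _ ⟨z, hz, rfl⟩
    obtain ⟨w, rfl⟩ : ∃ w, z = p + w := ⟨z - p, by ring⟩
    have hw1 : L ≤ w := by linarith [hz.1]
    have hw2 : w ≤ γ - β := by linarith [hz.2]
    -- The translate placed at offset v must stay inside the long arc (0 < v < γ - β) and contain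
    -- the offset w (w - β < v < w). Density of the orbit supplies such a v.
    have hlt : c + max 0 (w - β) < c + min w (γ - β) := by
      have : max 0 (w - β) < min w (γ - β) := by
        rw [max_lt_iff, lt_min_iff, lt_min_iff]
        exact ⟨⟨by linarith, by linarith⟩, by linarith, by linarith⟩
      linarith
    obtain ⟨t, ht, u, hu, hut⟩ := frequently_atTop.1 (frequently_orbit_mem (isOpen_openArc _ _)
      ((Set.nonempty_Ioo.2 hlt).image _)) 1
    obtain ⟨v, rfl⟩ : ∃ v, u = c + v := ⟨u - c, by ring⟩
    have h1 : max 0 (w - β) < v := by linarith [hu.1]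
    have h2 : v < min w (γ - β) := by linarith [hu.2]
    rw [max_lt_iff] at h1
    rw [lt_min_iff] at h2
    have htV : {orbit t} + V = openArc (p + v) (p + v + β) := by
      rw [← hut]; exact htrans v _ rfl
    refine Set.mem_iUnion₂.2 ⟨t, ⟨ht, ?_⟩, ?_⟩
    · rw [htV]
      exact openArc_mono (by linarith) (by linarith)
    · rw [htV]
      exact ⟨p + w, ⟨by linarith, by linarith⟩, rfl⟩
  obtain ⟨F, hFT, hF, hcov⟩ := (isCompact_closedArc _ _).elim_finite_subcover_image
    (fun t _ => ((isOpen_openArc _ _ : IsOpen V).add_left : IsOpen ({orbit t} + V))) hcover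
  refine ⟨insert 1 F, hF.insert 1, ?_, ?_, ?_⟩
  · rintro n (rfl | hn)
    exacts [le_rfl, (hFT hn).1]
  · rintro _ ⟨_, ⟨t, ht, rfl⟩, v, hv, rfl⟩
    have htT : t ∈ T := by
      rcases ht with rfl | ht
      exacts [hT1, hFT ht]
    exact htT.2 (Set.add_mem_add rfl hv)
  · have hmem : ∀ t ∈ insert 1 F, {orbit t} + V ⊆ orbit '' insert 1 F + V := fun t ht =>
      Set.add_subset_add_right (Set.singleton_subset_iff.2 (Set.mem_image_of_mem _ ht))
    rintro _ ⟨z, hz, rfl⟩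
    rcases lt_or_ge z (p + L) with h1 | h1
    · exact Or.inl ⟨z, ⟨hz.1, h1⟩, rfl⟩
    right
    rcases lt_or_ge (p + (γ - β)) z with h2 | h2
    · refine hmem 1 (Set.mem_insert _ _) ?_
      rw [hone]
      exact ⟨z, ⟨h2, hz.2⟩, rfl⟩
    · obtain ⟨t, ht, htz⟩ := Set.mem_iUnion₂.1 (hcov ⟨z, ⟨h1, h2⟩, rfl⟩)
      exact hmem t (Set.mem_insert_of_mem _ ht) htz

lemma exists_hasAsympDensity_kSumset {k : ℕ} (hk : 1 ≤ k) {β γ : ℝ} (hβ : 0 ≤ β) (hβ1 : β ≤ 1)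
    (hγ : 0 ≤ γ) (hγ1 : γ ≤ 1) (h : ((k : ℝ) + 1) / k * β ≤ γ ∨ γ = 1) :
    ∃ A : Set ℕ, (∀ n ∈ A, 1 ≤ n) ∧ (∀ i, 1 ≤ i → i < k → HasAsympDensity (kSumset i A) 0) ∧
      HasAsympDensity (kSumset k A) β ∧ HasAsympDensity (kSumset (k + 1) A) γ := by
  simp only [kSumset_eq_nsmul]
  have hk0 : (0 : ℝ) < k := by exact_mod_cast hk
  -- For β = 0 a thin basis of order k + 1 already makes the k-fold sumset null.
  rcases hβ.eq_or_lt with rfl | hβ0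
  · have hkU : (k + 1) • openArc 0 (γ / (k + 1)) = openArc 0 (0 + γ) := by
      rw [nsmul_openArc]
      congr 1 <;> field_simp <;> ring
    obtain ⟨A, hA1, hA0, hA, -⟩ := exists_thin_hasAsympDensity (k := k + 1) (by omega)
      (isOpen_openArc 0 (γ / (k + 1))) Set.finite_empty (by simp)
      (K := closedArc 0 (0 + γ)) (isCompact_closedArc _ _).isClosed (β := γ)
      (by rw [hkU]; exact openArc_subset_closedArc _ _)
      (by rw [hkU]; exact le_volume_real_openArc hγ1 _) (volume_real_closedArc_le hγ _)
    exact ⟨A, hA1, fun i _ hi => hA0 i (by omega), hA0 k (by omega), hA⟩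
  set L := ((k : ℝ) + 1) / k * β with hL
  have hβL : β < L := by
    rw [hL, div_mul_eq_mul_div, lt_div_iff₀ hk0]; nlinarith
  have hkU : ∀ c, k • openArc c (c + β / k) = openArc (k * c) (k * c + β) := by
    intro c
    obtain ⟨k, rfl⟩ := Nat.exists_eq_add_of_le' hk
    rw [nsmul_openArc]
    push_cast at hk0 ⊢
    congr 1
    field_simp
  have hkU' : ∀ c, (k + 1) • openArc c (c + β / k) =
      openArc ((k + 1) * c) ((k + 1) * c + L) := by
    intro c
    rw [nsmul_openArc, hL]
    congr 1
    field_simp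
  have hmain : ∀ (c : ℝ) (F : Set ℕ), F.Finite → (∀ n ∈ F, 1 ≤ n) → _ := fun c F hF hF1 =>
    exists_thin_hasAsympDensity hk
      (isOpen_openArc c (c + β / k)) hF hF1
      (K := closedArc (k * c) (k * c + β)) (isCompact_closedArc _ _).isClosed (β := β)
      (by rw [hkU]; exact openArc_subset_closedArc _ _)
      (by rw [hkU]; exact le_volume_real_openArc hβ1 _) (volume_real_closedArc_le hβ _)
  rcases le_or_gt L γ with hLγ | hLγ
  · obtain ⟨F, hF, hF1, hsub, hsup⟩ := exists_finite_translates (c := √2 - γ + β) k rfl hβ0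
      (hβL.trans_le hLγ) (hβ0.trans hβL)
    obtain ⟨A, hA1, hA0, hA, hA'⟩ := hmain (√2 - γ + β) F hF hF1
    rw [hkU, hkU'] at hA'
    refine ⟨A, hA1, fun i _ hi => hA0 i hi, hA, hA' (closedArc ((k + 1) * (√2 - γ + β))
      ((k + 1) * (√2 - γ + β) + γ)) γ (isCompact_closedArc _ _).isClosed ?_ ?_
      (volume_real_closedArc_le hγ _)⟩
    · exact (Set.union_subset (openArc_mono le_rfl (by linarith)) hsub).trans
        (openArc_subset_closedArc _ _)
    · exact (le_volume_real_openArc hγ1 _).trans (measureReal_mono hsup)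
  -- Here L > 1, so (k + 1)U is the whole circle and no translates are needed.
  · obtain rfl : γ = 1 := h.resolve_left hLγ.not_ge
    obtain ⟨A, hA1, hA0, hA, hA'⟩ := hmain 0 ∅ Set.finite_empty (by simp)
    have huniv : (volume : Measure UnitAddCircle).real Set.univ = 1 := by simp [measureReal_def]
    refine ⟨A, hA1, fun i _ hi => hA0 i hi, hA, hA' Set.univ 1 isClosed_univ
      (Set.subset_univ _) ?_ huniv.le⟩
    rw [hkU', openArc_eq_univ hLγ, Set.univ_union, huniv]

lemma mem_densityTuples_of_thin {k : ℕ} (hk : 1 ≤ k) {α : Fin (k + 1) → ℝ} {p : Fin (k + 1)}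
    (hp : (p : ℕ) + 1 = k)
    (hα : ∀ j, α j ∈ Set.Icc (0 : ℝ) 1) (h0 : ∀ j : Fin (k + 1), (j : ℕ) + 1 ≤ k - 1 → α j = 0)
    (h : (((k : ℝ) + 1) / (k : ℝ)) * α p ≤ α (Fin.last k) ∨
        (α p ≤ α (Fin.last k) ∧
          ∃ q : ℕ, 0 < q ∧ α (Fin.last k) = 1 / (q : ℝ))) :
    α ∈ densityTuples (k + 1) := by
  suffices ∃ A : Set ℕ, (∀ n ∈ A, 1 ≤ n) ∧
      (∀ i, 1 ≤ i → i < k → HasAsympDensity (kSumset i A) 0) ∧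
      HasAsympDensity (kSumset k A) (α p) ∧
      HasAsympDensity (kSumset (k + 1) A) (α (Fin.last k)) by
    obtain ⟨A, hA1, hA0, hA, hA'⟩ := this
    refine ⟨A, hA1, fun j => ?_⟩
    have hj := j.2
    rcases lt_trichotomy ((j : ℕ) + 1) k with hjk | hjk | hjk
    · rw [h0 j (by omega)]
      exact hA0 _ (by omega) hjk
    · have : j = p := Fin.ext (by omega)
      rw [hjk]
      exact this ▸ hA
    · have hjk' : (j : ℕ) = k := by omega
      have : j = Fin.last k := Fin.ext hjk'
      rw [hjk', this]
      exact hA'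
  rcases h with h | ⟨h, q, hq, hαq⟩
  · exact exists_hasAsympDensity_kSumset hk (hα _).1 (hα _).2 (hα _).1 (hα _).2 (Or.inl h)
  -- The pair (q·α p, 1) is realised first; dilation by q then divides all densities by q.
  · have hq' : (0 : ℝ) < q := by exact_mod_cast hq
    obtain ⟨A, hA1, hA0, hA, hA'⟩ := exists_hasAsympDensity_kSumset hk
      (β := q * α p) (γ := 1) (mul_nonneg hq'.le (hα _).1)
      (by rw [hαq, le_div_iff₀ hq'] at h; linarith) zero_le_one le_rfl (Or.inr rfl)
    refine ⟨(fun n => q * n) '' A, ?_, fun i hi hik => ?_, ?_, ?_⟩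
    · rintro _ ⟨n, hn, rfl⟩
      exact Nat.mul_pos hq (hA1 n hn)
    · rw [kSumset_nsmul_image]
      simpa using (hA0 i hi hik).nsmul_image hq
    · rw [kSumset_nsmul_image]
      have := hA.nsmul_image hq
      rwa [mul_div_cancel_left₀ _ hq'.ne'] at this
    · rw [kSumset_nsmul_image, hαq]
      exact hA'.nsmul_image hq

end ThinDensities

/-! ### Part (b): null sumsets on the circle from Cantor sets -/

section CircleThinSets

open scoped Pointwise

/-- σ-compactness is stable under sums and continuous images, so it guarantees that every sumset in
the construction is measurable. -/
lemma IsSigmaCompact.add_set {G : Type*} [AddMonoid G] [TopologicalSpace G] [ContinuousAdd G]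
    {s t : Set G} (hs : IsSigmaCompact s) (ht : IsSigmaCompact t) : IsSigmaCompact (s + t) := by
  obtain ⟨K, hK, rfl⟩ := hs
  obtain ⟨L, hL, rfl⟩ := ht
  rw [Set.iUnion_add]
  refine isSigmaCompact_iUnion _ fun n => ?_
  rw [Set.add_iUnion]
  exact isSigmaCompact_iUnion_of_isCompact _ fun m => (hK n).add (hL m)

lemma IsSigmaCompact.nsmul_set {G : Type*} [AddMonoid G] [TopologicalSpace G] [ContinuousAdd G]
    {s : Set G} (hs : IsSigmaCompact s) (i : ℕ) : IsSigmaCompact (i • s) := by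
  induction i with
  | zero =>
    rw [zero_nsmul, ← Set.singleton_zero]
    exact isCompact_singleton.isSigmaCompact
  | succ i ih =>
    rw [succ_nsmul]
    exact ih.add_set hs

lemma IsSigmaCompact.measurableSet' {X : Type*} [TopologicalSpace X] [T2Space X]
    [MeasurableSpace X] [BorelSpace X] {s : Set X} (hs : IsSigmaCompact s) : MeasurableSet s := by
  obtain ⟨K, hK, rfl⟩ := hs
  exact .iUnion fun n => (hK n).measurableSet

lemma volume_coe_image_eq_zero {N : Set ℝ} (hN : volume N = 0)
    (hm : MeasurableSet ((fun x : ℝ => (x : UnitAddCircle)) '' N)) :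
    volume ((fun x : ℝ => (x : UnitAddCircle)) '' N) = 0 := by
  rw [volume_eq_preimage hm 0]
  refine measure_mono_null (t := ⋃ n : ℤ, (n : ℝ) +ᵥ N) ?_ ?_
  · rintro x ⟨⟨y, hy, hyx⟩, -⟩
    obtain ⟨n, hn⟩ := AddSubgroup.mem_zmultiples_iff.1 (QuotientAddGroup.eq.1 hyx)
    refine Set.mem_iUnion.2 ⟨n, Set.mem_vadd_set.2 ⟨y, hy, ?_⟩⟩
    simp at hn
    simp [hn]
  · rw [measure_iUnion_null_iff]
    intro n
    rw [measure_vadd, hN]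

/-- The real numbers in `[0, 1]` having a base-`2 ^ m` expansion with digits in `{0, 1}`. -/
def sparseCantor (m : ℕ) : Set ℝ :=
  Set.range fun b : ℕ → Fin 2 => ∑' n, ((b n : ℕ) : ℝ) * ((2 ^ m : ℝ) ^ (n + 1))⁻¹

lemma summable_digits_mul {d : ℝ} (b : ℕ → Fin 2) (hd : 1 < d) :
    Summable fun n => ((b n : ℕ) : ℝ) * (d ^ (n + 1))⁻¹ := by
  refine Summable.of_nonneg_of_le (fun n => by positivity) (fun n => ?_)
    (summable_geometric_of_lt_one (r := d⁻¹) (by positivity) (inv_lt_one_of_one_lt₀ hd))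
  have h1 : ((b n : ℕ) : ℝ) ≤ 1 := by exact_mod_cast Nat.lt_succ_iff.1 (b n).2
  calc ((b n : ℕ) : ℝ) * (d ^ (n + 1))⁻¹ ≤ 1 * (d ^ n)⁻¹ := by
        gcongr
        · exact hd.le
        · omega
    _ = d⁻¹ ^ n := by rw [one_mul, inv_pow]

lemma one_lt_two_pow_real {m : ℕ} (hm : 1 ≤ m) : (1 : ℝ) < 2 ^ m :=
  one_lt_pow₀ one_lt_two (by omega)

lemma isCompact_sparseCantor {m : ℕ} (hm : 1 ≤ m) : IsCompact (sparseCantor m) := by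
  refine isCompact_range (continuous_tsum (u := fun n => ((2 ^ m : ℝ)⁻¹) ^ n) (fun n => ?_)
    (summable_geometric_of_lt_one (by positivity)
      (inv_lt_one_of_one_lt₀ (one_lt_two_pow_real hm))) fun n b => ?_)
  · have : Continuous fun d : Fin 2 => ((d : ℕ) : ℝ) := continuous_of_discreteTopology
    exact (this.comp (continuous_apply n)).mul continuous_const
  · have h1 : ((b n : ℕ) : ℝ) ≤ 1 := by exact_mod_cast Nat.lt_succ_iff.1 (b n).2
    rw [Real.norm_of_nonneg (by positivity)]
    calc ((b n : ℕ) : ℝ) * ((2 ^ m : ℝ) ^ (n + 1))⁻¹ ≤ 1 * ((2 ^ m : ℝ) ^ n)⁻¹ := by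
          gcongr
          · exact (one_lt_two_pow_real hm).le
          · omega
      _ = (2 ^ m : ℝ)⁻¹ ^ n := by rw [one_mul, inv_pow]

lemma exists_of_mem_sparseCantor {m : ℕ} (hm : 1 ≤ m) {c : ℝ} (hc : c ∈ sparseCantor m) :
    ∃ (d : Fin 2) (c' : ℝ), c' ∈ sparseCantor m ∧ c = (2 ^ m : ℝ)⁻¹ * (((d : ℕ) : ℝ) + c') := by
  obtain ⟨b, rfl⟩ := hc
  refine ⟨b 0, _, ⟨fun n => b (n + 1), rfl⟩, ?_⟩
  have hs := summable_digits_mul b (one_lt_two_pow_real hm)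
  simp only []
  rw [hs.tsum_eq_zero_add, mul_add, ← tsum_mul_left]
  congr 1
  · ring
  · refine tsum_congr fun n => ?_
    rw [pow_succ _ (n + 1), mul_inv]
    ring

/-- Every `y ∈ [0, 1)` is a sum of dilates of elements of `sparseCantor m`. -/
lemma exists_sparseCantor_sum {m : ℕ} (hm : 1 ≤ m) {y : ℝ} (hy : y ∈ Set.Ico (0 : ℝ) 1) :
    ∃ c : Fin m → ℝ, (∀ j, c j ∈ sparseCantor m) ∧ ∑ j : Fin m, 2 ^ (j : ℕ) * c j = y := by
  have h2 : 1 < 2 ^ m := Nat.one_lt_two_pow (by omega)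
  have : NeZero (2 ^ m) := ⟨by positivity⟩
  -- The j-th bits of all base-2^m digits of y form the expansion of c j.
  choose b hb hsum using fun n => exists_binary_sum m (Real.digits y (2 ^ m) n) (Fin.is_lt _)
  refine ⟨fun j => _, fun j => ⟨fun n => ⟨b n j, hb n j⟩, rfl⟩, ?_⟩
  rw [← Real.ofDigits_digits h2 hy, Real.ofDigits]
  simp only [← tsum_mul_left]
  rw [← Summable.tsum_finsetSum fun j _ =>
    (summable_digits_mul (fun n => ⟨b n j, hb n j⟩) (one_lt_two_pow_real hm)).mul_left _]
  refine tsum_congr fun n => ?_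
  rw [Real.ofDigitsTerm, ← hsum n]
  push_cast
  rw [Finset.sum_mul]
  exact Finset.sum_congr rfl fun j _ => by ring

/-- Splitting off the first digits covers D by 2^i translates of D shrunk by 2^(-m). Since D is
compact, its measure is finite, and |D| ≤ 2^(i-m)·|D| with i < m forces it to vanish. -/
lemma volume_sparseCantor_sum {m i : ℕ} (hm : 1 ≤ m) (hi : i < m) (f : Fin i → ℕ) :
    volume {x : ℝ | ∃ c : Fin i → ℝ, (∀ l, c l ∈ sparseCantor m) ∧
      ∑ l, 2 ^ f l * c l = x} = 0 := by
  set D := {x : ℝ | ∃ c : Fin i → ℝ, (∀ l, c l ∈ sparseCantor m) ∧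
      ∑ l, 2 ^ f l * c l = x} with hD
  have hDc : IsCompact D := by
    have h1 : IsCompact (Set.pi Set.univ fun _ : Fin i => sparseCantor m) :=
      isCompact_univ_pi fun _ => isCompact_sparseCantor hm
    have h2 : D = (fun c : Fin i → ℝ => ∑ l, 2 ^ f l * c l) ''
        (Set.pi Set.univ fun _ : Fin i => sparseCantor m) := by
      ext x; simp [hD]
    rw [h2]
    exact h1.image (by fun_prop)
  have hsub : D ⊆ ⋃ b : Fin i → Fin 2, (2 ^ m : ℝ)⁻¹ •
      ((∑ l, (2 : ℝ) ^ f l * ((b l : ℕ) : ℝ)) +ᵥ D) := by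
    rintro _ ⟨c, hc, rfl⟩
    choose d c' hc' hcd using fun l => exists_of_mem_sparseCantor hm (hc l)
    refine Set.mem_iUnion.2 ⟨d, Set.mem_smul_set.2 ⟨_, Set.mem_vadd_set.2
      ⟨_, ⟨c', hc', rfl⟩, rfl⟩, ?_⟩⟩
    rw [vadd_eq_add, smul_eq_mul, ← Finset.sum_add_distrib, Finset.mul_sum]
    refine Finset.sum_congr rfl fun l _ => ?_
    rw [hcd l]
    ring
  have hfin : volume D ≠ ⊤ := hDc.measure_lt_top.ne
  have hle : volume.real D ≤ 2 ^ i * ((2 ^ m : ℝ)⁻¹ * volume.real D) := by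
    have h1 : ∀ b : Fin i → Fin 2, volume ((2 ^ m : ℝ)⁻¹ •
        ((∑ l, (2 : ℝ) ^ f l * ((b l : ℕ) : ℝ)) +ᵥ D)) =
        ENNReal.ofReal (2 ^ m : ℝ)⁻¹ * volume D := by
      intro b
      rw [Measure.addHaar_smul, measure_vadd]
      simp
    have h2 : volume D ≤ 2 ^ i * (ENNReal.ofReal (2 ^ m : ℝ)⁻¹ * volume D) := by
      refine (measure_mono hsub).trans ((measure_iUnion_le _).trans ?_)
      simp [h1, tsum_fintype]
    have h3 := ENNReal.toReal_mono (by finiteness) h2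
    rw [ENNReal.toReal_mul, ENNReal.toReal_mul, ENNReal.toReal_ofReal (by positivity)] at h3
    simpa [measureReal_def] using h3
  have hlt : (2 : ℝ) ^ i * (2 ^ m : ℝ)⁻¹ < 1 := by
    rw [mul_inv_lt_iff₀ (by positivity), one_mul]
    exact pow_lt_pow_right₀ one_lt_two hi
  have h0 : volume.real D = 0 := by
    have := measureReal_nonneg (μ := volume) (s := D)
    nlinarith
  exact (measureReal_eq_zero_iff hfin).1 h0

/-- Rational translates of dilates of `sparseCantor m`, restricted to `[0, l]`. -/
def thinReals (m : ℕ) (l : ℝ) : Set ℝ :=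
  {x | ∃ j < m, ∃ c ∈ sparseCantor m, ∃ q : ℚ, x = 2 ^ j * c + q} ∩ Set.Icc 0 l

lemma isSigmaCompact_thinReals {m : ℕ} (hm : 1 ≤ m) (l : ℝ) :
    IsSigmaCompact (thinReals m l) := by
  have : thinReals m l = ⋃ p : Fin m × ℚ,
      ((fun c : ℝ => 2 ^ (p.1 : ℕ) * c + p.2) '' sparseCantor m) ∩ Set.Icc 0 l := by
    ext x
    simp only [thinReals, Set.mem_inter_iff, Set.mem_iUnion, Set.mem_image]
    constructor
    · rintro ⟨⟨j, hj, c, hc, q, rfl⟩, hx⟩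
      exact ⟨(⟨j, hj⟩, q), ⟨c, hc, rfl⟩, hx⟩
    · rintro ⟨⟨j, q⟩, ⟨c, hc, rfl⟩, hx⟩
      exact ⟨⟨j, j.2, c, hc, q, rfl⟩, hx⟩
  rw [this]
  exact isSigmaCompact_iUnion_of_isCompact _ fun p =>
    ((isCompact_sparseCantor hm).image (by fun_prop)).inter_right isClosed_Icc

/-- There are only countably many choices of dilation exponents and of total rational shift, and
each gives a null set. -/
lemma volume_nsmul_thinReals {m i : ℕ} (hm : 1 ≤ m) (hi : i < m) (l : ℝ) :
    volume (i • thinReals m l) = 0 := by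
  refine measure_mono_null (t := ⋃ p : (Fin i → Fin m) × ℚ, (p.2 : ℝ) +ᵥ
    {x : ℝ | ∃ c : Fin i → ℝ, (∀ l, c l ∈ sparseCantor m) ∧
      ∑ l, 2 ^ (p.1 l : ℕ) * c l = x}) ?_ ?_
  · rw [← kSumset_eq_nsmul]
    rintro _ ⟨a, ha, rfl⟩
    choose j hj c hc q hq using fun n => (ha n).1
    refine Set.mem_iUnion.2 ⟨(fun n => ⟨j n, hj n⟩, ∑ n, q n), Set.mem_vadd_set.2
      ⟨_, ⟨c, hc, rfl⟩, ?_⟩⟩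
    simp only [hq, vadd_eq_add, Finset.sum_add_distrib]
    push_cast
    ring
  · rw [measure_iUnion_null_iff]
    intro p
    rw [measure_vadd]
    exact volume_sparseCantor_sum hm hi _

/-- Write y as a sum of dilated Cantor points, then add rationals with sum 0 that bring every
summand close to the mean y/m, hence into [0, γ/m]. -/
lemma Ioo_subset_nsmul_thinReals {m : ℕ} (hm : 1 ≤ m) {γ : ℝ} (hγ1 : γ ≤ 1) :
    Set.Ioo 0 γ ⊆ m • thinReals m (γ / m) := by
  obtain ⟨k, rfl⟩ := Nat.exists_eq_add_of_le' hm
  rintro y ⟨hy0, hyγ⟩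
  rw [← kSumset_eq_nsmul]
  obtain ⟨c, hc, hsum⟩ := exists_sparseCantor_sum hm ⟨hy0.le, hyγ.trans_le hγ1⟩
  have hk : (0 : ℝ) < k + 1 := by positivity
  set u := y / (k + 1) with hu
  set w := γ / (k + 1) with hw
  have hu0 : 0 < u := by positivity
  have huw : u < w := by rw [hu, hw]; gcongr
  have hη : 0 < min u (w - u) / (k + 1) := div_pos (lt_min hu0 (by linarith)) hk
  -- The distance from the mean u to the ends of [0, w]. The first k summands are placed within η/(k
  -- + 1) below u, so the last exceeds u by at most η.
  set η := min u (w - u) with hηdef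
  choose r hr1 hr2 using fun j : Fin k => exists_rat_btwn
    (show u - 2 ^ (j : ℕ) * c j.castSucc - η / (k + 1) < u - 2 ^ (j : ℕ) * c j.castSucc by linarith)
  let e : Fin (k + 1) → ℚ := Fin.snoc (α := fun _ => ℚ) r (-∑ j, r j)
  have hesum : ∑ j, e j = 0 := by
    simp [e, Fin.sum_univ_castSucc]
  let a : Fin (k + 1) → ℝ := fun j => 2 ^ (j : ℕ) * c j + e j
  have hasum : ∑ j, a j = y := by
    simp only [a, Finset.sum_add_distrib, hsum]
    rw [← Rat.cast_sum, hesum, Rat.cast_zero, add_zero]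
  have hηle : η / (k + 1) ≤ η :=
    div_le_self (le_min hu0.le (by linarith)) (by linarith [k.cast_nonneg (α := ℝ)])
  have hηu : η ≤ u := min_le_left _ _
  have hηw : η ≤ w - u := min_le_right _ _
  have hclose : ∀ j : Fin k, u - η / (k + 1) ≤ a j.castSucc ∧ a j.castSucc ≤ u := by
    intro j
    simp only [a, e, Fin.snoc_castSucc, Fin.val_castSucc]
    constructor
    · linarith [hr1 j]
    · linarith [hr2 j]
  have hlast : u ≤ a (Fin.last k) ∧ a (Fin.last k) ≤ u + η := by
    have h1 : ∑ j : Fin k, a j.castSucc + a (Fin.last k) = (k + 1) * u := by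
      rw [← Fin.sum_univ_castSucc, hasum, hu]
      field_simp
    have h2 : ∑ j : Fin k, a j.castSucc ≤ k * u := by
      simpa using Finset.sum_le_sum fun j (_ : j ∈ Finset.univ) => (hclose j).2
    have h3 : k * (u - η / (k + 1)) ≤ ∑ j : Fin k, a j.castSucc := by
      simpa [mul_sub] using Finset.sum_le_sum fun j (_ : j ∈ Finset.univ) => (hclose j).1
    have h4 : k * (η / (k + 1)) ≤ η := by
      have : (k + 1) * (η / (k + 1)) = η := by field_simp
      linarith
    constructor <;> linarith
  refine ⟨a, fun j => ⟨⟨j, j.2, c j, hc j, e j, rfl⟩, ?_⟩, hasum⟩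
  push_cast
  rw [← hw]
  refine Fin.lastCases ?_ (fun j => ?_) j
  · exact ⟨by linarith [hlast.1], by linarith [hlast.2]⟩
  · exact ⟨by linarith [(hclose j).1], by linarith [(hclose j).2]⟩

lemma nsmul_Icc_subset (i : ℕ) (l : ℝ) : i • Set.Icc 0 l ⊆ Set.Icc 0 (i * l) := by
  rw [← kSumset_eq_nsmul]
  rintro _ ⟨a, ha, rfl⟩
  refine ⟨Finset.sum_nonneg fun j _ => (ha j).1, ?_⟩
  simpa using Finset.sum_le_sum fun j (_ : j ∈ Finset.univ) => (ha j).2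

lemma mem_circleTuples_of_thin {k : ℕ} {α : Fin (k + 1) → ℝ}
    (hα : ∀ j, α j ∈ Set.Icc (0 : ℝ) 1) (h0 : ∀ j : Fin (k + 1), (j : ℕ) + 1 ≤ k → α j = 0) :
    α ∈ circleTuples (k + 1) := by
  set γ := α (Fin.last k) with hγ
  set S := thinReals (k + 1) (γ / (k + 1 : ℕ)) with hS
  have himage : ∀ i : ℕ, kSumset i ((fun x : ℝ => (x : UnitAddCircle)) '' S) =
      (fun x : ℝ => (x : UnitAddCircle)) '' (i • S) := fun i => by
    rw [kSumset_eq_nsmul]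
    exact (Set.image_nsmul (QuotientAddGroup.mk' (AddSubgroup.zmultiples (1 : ℝ))) _ _).symm
  have hmeas : ∀ i : ℕ, MeasurableSet ((fun x : ℝ => (x : UnitAddCircle)) '' (i • S)) := fun i =>
    (((isSigmaCompact_thinReals (by omega) _).nsmul_set i).image
      (AddCircle.continuous_mk' 1)).measurableSet'
  refine ⟨(fun x : ℝ => (x : UnitAddCircle)) '' S, fun j => ?_⟩
  rw [himage]
  refine ⟨hmeas _, ?_⟩
  have hj := j.2
  rcases lt_or_ge (j : ℕ) k with hjk | hjk
  · rw [h0 j hjk, measureReal_def,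
      volume_coe_image_eq_zero (volume_nsmul_thinReals (by omega) (by omega) _) (hmeas _),
      ENNReal.toReal_zero]
  · have hjk' : (j : ℕ) = k := by omega
    have hjl : j = Fin.last k := Fin.ext hjk'
    rw [hjk', hjl, ← hγ]
    apply le_antisymm
    · refine le_trans (measureReal_mono (s₂ := closedArc 0 (0 + γ)) (Set.image_mono ?_)
        (measure_ne_top _ _)) (volume_real_closedArc_le (hα _).1 0)
      refine (Set.nsmul_subset_nsmul_left Set.inter_subset_right).trans
        ((nsmul_Icc_subset _ _).trans_eq ?_)
      rw [mul_div_cancel₀ _ (by positivity), zero_add]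
    · refine (le_volume_real_openArc (hα _).2 0).trans (measureReal_mono (Set.image_mono ?_)
        (measure_ne_top _ _))
      rw [zero_add]
      exact Ioo_subset_nsmul_thinReals (by omega) (hα _).2

end CircleThinSets

/-! ### Part (c): from open subsets of the circle to sets of integers -/

section OpenSets

open scoped Pointwise

/-- A diagonal choice: s N is the largest s ≤ N for which P s holds from N onwards. Asking for all
N' ≥ N makes s monotone. -/
lemma exists_monotone_tendsto_eventually {P : ℕ → ℕ → Prop} (h : ∀ s, ∀ᶠ N in atTop, P s N) :
    ∃ s : ℕ → ℕ, Monotone s ∧ Tendsto s atTop atTop ∧ ∀ᶠ N in atTop, P (s N) N := by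
  classical
  let Q : ℕ → ℕ → Prop := fun N s => ∀ N' ≥ N, P s N'
  have hQ : ∀ s, ∀ᶠ N in atTop, Q N s := fun s => by
    obtain ⟨M, hM⟩ := eventually_atTop.1 (h s)
    filter_upwards [eventually_ge_atTop M] with N hN N' hN'
    exact hM N' (hN.trans hN')
  refine ⟨fun N => Nat.findGreatest (Q N) N, fun N N' hN => ?_, ?_, ?_⟩
  · exact Nat.findGreatest_mono (fun s hs N'' hN'' => hs N'' (hN.trans hN'')) hN
  · refine tendsto_atTop.2 fun s => ?_
    filter_upwards [hQ s, eventually_ge_atTop s] with N hN hsN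
    exact Nat.le_findGreatest hsN hN
  -- `Nat.findGreatest` defaults to 0, so its value satisfies the predicate once Q N 0 holds.
  · filter_upwards [hQ 0] with N hN
    exact Nat.findGreatest_spec (P := Q N) (Nat.zero_le N) hN N le_rfl

/-- The points at distance at least 1/(s + 1) from the complement. The extended distance also covers
A = 𝕋, where the complement is empty and the distance infinite. -/
lemma exists_compact_exhaustion {A : Set UnitAddCircle} (hA : IsOpen A) :
    ∃ K : ℕ → Set UnitAddCircle, Monotone K ∧ (∀ s, IsCompact (K s)) ∧ (∀ s, K s ⊆ A) ∧
      ∀ y ∈ A, ∃ s, K s ∈ 𝓝 y := by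
  refine ⟨fun s => {x | ((s : ENNReal) + 1)⁻¹ ≤ Metric.infEDist x Aᶜ}, fun s t hst x hx => ?_,
    fun s => ?_, fun s x hx => ?_, fun y hy => ?_⟩
  · refine le_trans (b := ((s : ENNReal) + 1)⁻¹) ?_ hx
    gcongr
  · exact (isClosed_le continuous_const Metric.continuous_infEDist).isCompact
  · by_contra hxA
    have h0 : Metric.infEDist x Aᶜ = 0 := Metric.infEDist_zero_of_mem hxA
    have h1 : ((s : ENNReal) + 1)⁻¹ ≤ 0 := h0 ▸ hx
    simp at h1
  · have hpos : Metric.infEDist y Aᶜ ≠ 0 := fun h =>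
      (Metric.mem_iff_infEDist_zero_of_closed hA.isClosed_compl).2 h hy
    obtain ⟨s, hs⟩ := ENNReal.exists_inv_nat_lt hpos
    refine ⟨s, ?_⟩
    have hlt : ((s : ENNReal) + 1)⁻¹ < Metric.infEDist y Aᶜ :=
      (ENNReal.inv_le_inv.2 le_self_add).trans_lt hs
    filter_upwards [Metric.continuous_infEDist.continuousAt.eventually (lt_mem_nhds hlt)] with x hx
    exact hx.le

lemma nsmul_inter_Iic_subset (i N : ℕ) (B : Set ℕ) :
    (i • B) ∩ Set.Iic N ⊆ i • (B ∩ Set.Iic N) := by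
  rw [← kSumset_eq_nsmul, ← kSumset_eq_nsmul]
  rintro _ ⟨⟨a, ha, rfl⟩, hN⟩
  exact ⟨a, fun j => ⟨ha j, (Finset.single_le_sum (fun _ _ => Nat.zero_le _)
    (Finset.mem_univ j)).trans hN⟩, rfl⟩

lemma isCompact_nsmul {K : Set UnitAddCircle} (hK : IsCompact K) (i : ℕ) : IsCompact (i • K) := by
  induction i with
  | zero =>
    rw [zero_nsmul, ← Set.singleton_zero]
    exact isCompact_singleton
  | succ i ih =>
    rw [succ_nsmul]
    exact ih.add hK

/-- The measures of the sumsets of an open set are densities of sumsets of a set of integers. -/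
lemma exists_hasAsympDensity_of_isOpen {A : Set UnitAddCircle} (hA : IsOpen A) (m : ℕ) :
    ∃ B : Set ℕ, (∀ n ∈ B, 1 ≤ n) ∧ ∀ i < m, HasAsympDensity (kSumset (i + 1) B)
      ((volume : Measure UnitAddCircle).real (kSumset (i + 1) A)) := by
  simp only [kSumset_eq_nsmul]
  obtain ⟨K, hKmono, hKc, hKA, hKnhds⟩ := exists_compact_exhaustion hA
  obtain ⟨s, hsmono, hs_lim, hsP⟩ := exists_monotone_tendsto_eventually
    (P := fun s N => ∀ i < m, (((orbit ⁻¹' ((i + 1) • K s)) ∩ Set.Icc 1 N).ncard : ℝ) ≤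
      ((volume : Measure UnitAddCircle).real ((i + 1) • A) + 1 / ((s : ℝ) + 1)) * N)
    (fun s => (Set.finite_Iio m).eventually_all.2 fun i _ =>
      ((asympDensityLE_preimage_orbit (isCompact_nsmul (hKc s) (i + 1)).isClosed).le
        (measureReal_mono (Set.nsmul_subset_nsmul_left (hKA s)))) _ Nat.one_div_pos_of_nat)
  -- By monotonicity, elements of B up to N have orbit points in K (s N), so (i + 1)B up to N lies
  -- over (i + 1)K (s N), and s was chosen to grow slowly enough for that count to be controlled. As
  -- s tends to infinity, B still captures all of A, which gives the lower bound.
  set B : Set ℕ := {n | 1 ≤ n ∧ orbit n ∈ K (s n)} with hB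
  have hcap : Captures B A := by
    intro y hy
    obtain ⟨t, ht⟩ := hKnhds y hy
    obtain ⟨M, hM⟩ := eventually_atTop.1 (hs_lim.eventually_ge_atTop t)
    exact ⟨K t, ht, max M 1, fun x hx hxK =>
      ⟨(le_max_right _ _).trans hx, hKmono (hM x ((le_max_left _ _).trans hx)) hxK⟩⟩
  refine ⟨B, fun n hn => hn.1, fun i hi => hasAsympDensity_of_le_of_ge ?_
    ((hcap.succ_nsmul i).asympDensityGE (isOpen_succ_nsmul hA i))⟩
  intro ε hε
  have hlim : Tendsto (fun N => 1 / ((s N : ℝ) + 1)) atTop (𝓝 0) :=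
    tendsto_one_div_add_atTop_nhds_zero_nat.comp hs_lim
  filter_upwards [hsP, hlim.eventually (eventually_le_nhds hε)] with N hN hNε
  refine le_trans (Nat.cast_le.2 ?_) ((hN i hi).trans
    (mul_le_mul_of_nonneg_right (by linarith) N.cast_nonneg))
  refine Set.ncard_le_ncard ?_ ((Set.finite_Icc 1 N).subset Set.inter_subset_right)
  rintro x ⟨hx, hxN⟩
  refine ⟨?_, hxN⟩
  refine nsmul_subset_preimage orbit ?_ (i + 1) (nsmul_inter_Iic_subset _ _ _ ⟨hx, hxN.2⟩)
  rintro n ⟨hn, hnN⟩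
  exact hKmono (hsmono hnN) hn.2

lemma circleOpenTuples_subset_densityTuples (m : ℕ) : circleOpenTuples m ⊆ densityTuples m := by
  rintro α ⟨A, hA, -, hα⟩
  obtain ⟨B, hB1, hB⟩ := exists_hasAsympDensity_of_isOpen hA m
  exact ⟨B, hB1, fun j => hα j ▸ hB j j.2⟩

lemma volume_frontier_openArc {l : ℝ} (hl : l ≤ 1) (a : ℝ) :
    volume (frontier (openArc a (a + l))) = 0 := by
  have hsub : frontier (openArc a (a + l)) ⊆
      closedArc a (a + l) \ openArc a (a + l) := by
    rw [(isOpen_openArc _ _).frontier_eq]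
    exact Set.sdiff_subset_sdiff_left (closure_minimal (openArc_subset_closedArc _ _)
      (isCompact_closedArc _ _).isClosed)
  refine measure_mono_null hsub ?_
  rw [measure_sdiff (openArc_subset_closedArc _ _)
    (isOpen_openArc _ _).measurableSet.nullMeasurableSet (measure_ne_top _ _)]
  exact tsub_eq_zero_of_le ((volume_closedArc_le _ _).trans (volume_openArc_ge hl _))

lemma mem_circleOpenTuples_of_linear {k : ℕ} {α : Fin (k + 1) → ℝ}
    (hα : ∀ j, α j ∈ Set.Icc (0 : ℝ) 1) {a : ℝ}
    (h : ∀ j : Fin (k + 1), α j = (((j : ℕ) : ℝ) + 1) * a) : α ∈ circleOpenTuples (k + 1) := by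
  have ha : a = α 0 := by rw [h 0]; simp
  refine ⟨openArc 0 (0 + a), isOpen_openArc _ _,
    volume_frontier_openArc (ha ▸ (hα 0).2) _, fun j => ?_⟩
  rw [kSumset_eq_nsmul, nsmul_openArc, mul_zero, zero_add, ← h j]
  simpa using volume_real_openArc (hα j).1 (hα j).2 0

end OpenSets

theorem theorem6 (k : ℕ) (hk : 1 ≤ k) (α : Fin (k + 1) → ℝ)
    (hα : ∀ j, α j ∈ Set.Icc (0 : ℝ) 1) :
    ((∀ j : Fin (k + 1), (j : ℕ) + 1 ≤ k - 1 → α j = 0) →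
      ((((k : ℝ) + 1) / (k : ℝ)) * α ⟨k - 1, by omega⟩ ≤ α (Fin.last k) ∨
        (α ⟨k - 1, by omega⟩ ≤ α (Fin.last k) ∧
          ∃ q : ℕ, 0 < q ∧ α (Fin.last k) = 1 / (q : ℝ))) →
      α ∈ densityTuples (k + 1)) ∧
    ((∀ j : Fin (k + 1), (j : ℕ) + 1 ≤ k → α j = 0) →
      α ∈ circleTuples (k + 1)) ∧
    (∀ a : ℝ, a ≤ 1 / ((k : ℝ) + 1) →
      (∀ j : Fin (k + 1), α j = (((j : ℕ) : ℝ) + 1) * a) →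
      α ∈ circleOpenTuples (k + 1) ∧
        circleOpenTuples (k + 1) ⊆ densityTuples (k + 1)) :=
  ⟨mem_densityTuples_of_thin hk (Nat.sub_add_cancel hk) hα, mem_circleTuples_of_thin hα, fun _ _ h =>
    ⟨mem_circleOpenTuples_of_linear hα h, circleOpenTuples_subset_densityTuples _⟩⟩
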